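/- Fix integers $p,q\ge 1$, a $q\times p$ matrix $Z=(\zeta_{ji})$ of non-negative integers without zero rows and zero columns, and non-negative integers $\Lambda=(\lambda_1,\dots,\lambda_q)$. Let $\mathbb N_1,\dots,\mathbb N_p$ be copies of $\mathbb N=\{1,2,\dots\}$, let $\mathbb I(\zeta)$ be a set with $\zeta$ elements and $L_j$ a set with $\lambda_j$ elements, and put $\Omega_j=L_j\sqcup\coprod_{i\le p}\bigl(\mathbb N_i\times\mathbb I(\zeta_{ji})\bigr)$. For a set $\Omega$ let $\mathbb S_\infty(\Omega)$ be the group of permutations of $\Omega$ that fix all but finitely many points. Let $$G=\prod_{j=1}^q\mathbb S_\infty(\Omega_j),\qquad K^\circ=\prod_{i=1}^p\Bigl(\mathbb S_\infty(\mathbb N_i)\ltimes\bigl(\textstyle\prod_j S_{\zeta_{ji}}\bigr)^\infty\Bigr)\subset G,\qquad K^\circledast=\prod_{i=1}^p\mathbb S_\infty(\mathbb N_i)\subset K^\circ,$$ where $U^\infty$ is the group of finitely supported sequences in $U$, $\mathbb S_\infty(\mathbb N_i)$ acts on the first factor of all the sets $\mathbb N_i\times\mathbb I(\zeta_{ji})$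 simultaneously, and the $n$-th factor of $(\prod_j S_{\zeta_{ji}})^\infty$ permutes each of the sets $\{n\}\times\mathbb I(\zeta_{ji})$. Let $K$ be $K^\circ$ or $K^\circledast$. For a multi-index $\alpha=(\alpha_1,\dots,\alpha_p)$ of non-negative integers let $K^\alpha\subset K$ be the subgroup of elements whose components in $\mathbb S_\infty(\mathbb N_i)$ fix $1,\dots,\alpha_i$ and whose components in $(\prod_j S_{\zeta_{ji}})^\infty$ (for $K=K^\circ$) are trivial at the first $\alpha_i$ places, for all $i$. Let $\Theta_N^{[\alpha]}\in K^\alpha\cap K^\circledast$ be the element whose $i$-th component is the permutation of $\mathbb N_i$ that exchanges $\alpha_i+t$ and $\alpha_i+N+t$ for $1\le t\le N$ and fixes all other points. The category $\mathbb T(G,K)$ has the multi-indices $\alpha$ as objects and the double cosets $K^\beta\backslash G/K^\alpha$ as morphisms $\alpha\to\beta$; the composition of $\mathfrak h=K^\beta hK^\alpha$ and $\mathfrak g=K^\gamma gK^\beta$ is $$\mathfrak g\circ\mathfrak h=\lim_{N\to\infty}K^\gamma\, g\,\Theta_N^{[\beta]}\,h\,K^\alpha$$ (the sequence is eventually constant,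 its limit does not depend on the representatives $g$, $h$, and this product is associative, with the double cosets of $1$ as units). The map $g\mapsto g^{-1}$ induces an involution $\mathfrak g\mapsto\mathfrak g^\square$ from morphisms $\alpha\to\beta$ to morphisms $\beta\to\alpha$. A unitary representation $\rho$ of $G$ in a complex Hilbert space $H$ is called $K$-admissible if $\bigcup_\alpha H^\alpha$ is dense in $H$, where $H^\alpha$ is the subspace of $K^\alpha$-fixed vectors. A contractive $*$-representation of $\mathbb T(G,K)$ consists of complex Hilbert spaces $V_\alpha$ and bounded operators $T(\mathfrak g):V_\alpha\to V_\beta$ for all $\mathfrak g:\alpha\to\beta$, such that $T(1_\alpha)=1$, $T(\mathfrak g\circ\mathfrak h)=T(\mathfrak g)T(\mathfrak h)$, $T(\mathfrak g^\square)=T(\mathfrak g)^*$ and $\|T(\mathfrak g)\|\le 1$. Theorem. Let $\rho$ be a $K$-admissible unitary representation of $G$ in $H$ and let $P^\beta$ be the orthogonal projection of $H$ onto $H^\beta$. For $g\in\mathfrak g\in K^\beta\backslash G/K^\alpha$ the operator $\overline\rho_{\alpha,\beta}(\mathfrak g):=P^\beta\rho(g)|_{H^\alpha}:H^\alpha\to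 H^\beta$ depends only on $\mathfrak g$, and the spaces $H^\alpha$ with these operators form a contractive $*$-representation of $\mathbb T(G,K)$. The map $\rho\mapsto\overline\rho$ induces a bijection between the set of unitary equivalence classes of $K$-admissible unitary representations of $G$ and the set of unitary equivalence classes of contractive $*$-representations of $\mathbb T(G,K)$. -/

import Mathlib

universe u

namespace SymTrain

open Equiv CategoryTheory

/-- The group of finite permutations of a set `X`: all but finitely many points are fixed. -/
def finitary (X : Type*) : Subgroup (Perm X) where
  carrier := {σ | {x | σ x ≠ x}.Finite}
  one_mem' := by simp
  mul_mem' := by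
    intro a b ha hb
    refine (ha.union hb).subset fun x hx => ?_
    by_contra h
    simp only [Set.mem_union, Set.mem_ofPred_eq, not_or, not_not] at h
    exact hx (by simp [h.1, h.2])
  inv_mem' := by
    intro a ha
    refine ha.subset fun x hx h => hx ?_
    exact (Perm.inv_eq_iff_eq).2 h.symm

lemma mem_finitary_iff {X : Type*} {σ : Perm X} : σ ∈ finitary X ↔ {x | σ x ≠ x}.Finite :=
  Iff.rfl

lemma finite_nat_iff {P : ℕ → Prop} : {n | ¬ P n}.Finite ↔ ∃ M, ∀ n, M ≤ n → P n := by
  constructor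
  · intro h
    obtain ⟨M, hM⟩ := h.bddAbove
    refine ⟨M + 1, fun n hn => ?_⟩
    by_contra hp
    have : n ≤ M := hM hp
    omega
  · rintro ⟨M, hM⟩
    refine (Set.finite_lt_nat M).subset fun n hn => ?_
    by_contra h
    exact hn (hM n (not_lt.1 h))

variable {p q : ℕ}

/-- The set `Ω_j = L_j ⊔ ∐_i (ℕ_i × 𝕀(ζ_{ji}))`, with `L_j = Fin (Λ j)` and `𝕀(ζ) = Fin ζ`. -/
abbrev Omega (Z : Matrix (Fin q) (Fin p) ℕ) (Λ : Fin q → ℕ) (j : Fin q) : Type :=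
  Fin (Λ j) ⊕ (Σ i : Fin p, ℕ × Fin (Z j i))

/-- The group `G[Z, Λ] = ∏_j 𝕊_∞(Ω_j)`. -/
abbrev GGroup (Z : Matrix (Fin q) (Fin p) ℕ) (Λ : Fin q → ℕ) : Type :=
  ∀ j : Fin q, finitary (Omega Z Λ j)

/-- The permutation of `Ω_j` given by permutations `σ_i` of `ℕ_i` and, for every `i` and every
`n ∈ ℕ_i`, permutations of the finite sets `{n} × 𝕀(ζ_{ji})`: it fixes `L_j` pointwise and sends
`(n, m) ∈ ℕ_i × 𝕀(ζ_{ji})` to `(σ_i n, u_{i,n,j} m)`. -/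
def wreathPerm (Z : Matrix (Fin q) (Fin p) ℕ) (Λ : Fin q → ℕ) (σ : Fin p → Perm ℕ)
    (u : ∀ i : Fin p, ℕ → ∀ j : Fin q, Perm (Fin (Z j i))) (j : Fin q) : Perm (Omega Z Λ j) :=
  Equiv.sumCongr (Equiv.refl _)
    (Equiv.sigmaCongrRight fun i => Equiv.prodShear (σ i) fun n => u i n j)

/-- The two kinds of subgroups `K ⊂ G`: `K^∘[Z]` and `K^⊛[Z]`. -/
inductive PairKind : Type
  | circ
  | circledast

/-- The group acting inside a column: all of `∏_j S_{ζ_{ji}}` for `K^∘`, and the trivial group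
for `K^⊛`. -/
def PairKind.inner (κ : PairKind) (Z : Matrix (Fin q) (Fin p) ℕ) (i : Fin p) :
    Subgroup (∀ j : Fin q, Perm (Fin (Z j i))) :=
  match κ with
  | .circ => ⊤
  | .circledast => ⊥

/-- `(σ, u)` is an element of the product over `i` of the semidirect products
`𝕊_∞^{α_i}(ℕ_i) ⋉ (U_i)^{∞ - α_i}`, where `U_i` is `κ.inner Z i`. The first `α_i` elements of
`ℕ_i` are those with `n < α_i`. -/
structure IsWreath (κ : PairKind) {Z : Matrix (Fin q) (Fin p) ℕ} (α : Fin p → ℕ)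
    (σ : Fin p → Perm ℕ) (u : ∀ i : Fin p, ℕ → ∀ j : Fin q, Perm (Fin (Z j i))) : Prop where
  perm_finitary : ∀ i, σ i ∈ finitary ℕ
  finite_support : ∀ i, {n | u i n ≠ 1}.Finite
  mem_inner : ∀ i n, u i n ∈ κ.inner Z i
  perm_fix : ∀ i n, n < α i → σ i n = n
  inner_fix : ∀ i n, n < α i → u i n = 1

section Wreath

variable {κ : PairKind} {Z : Matrix (Fin q) (Fin p) ℕ} {Λ : Fin q → ℕ}

@[simp] lemma wreathPerm_inl (σ : Fin p → Perm ℕ)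
    (u : ∀ i : Fin p, ℕ → ∀ j : Fin q, Perm (Fin (Z j i))) (j : Fin q) (l : Fin (Λ j)) :
    wreathPerm Z Λ σ u j (Sum.inl l) = Sum.inl l := rfl

@[simp] lemma wreathPerm_inr (σ : Fin p → Perm ℕ)
    (u : ∀ i : Fin p, ℕ → ∀ j : Fin q, Perm (Fin (Z j i))) (j : Fin q) (i : Fin p) (n : ℕ)
    (m : Fin (Z j i)) :
    wreathPerm Z Λ σ u j (Sum.inr ⟨i, n, m⟩) = Sum.inr ⟨i, σ i n, u i n j m⟩ := rfl

lemma wreathPerm_one (j : Fin q) : wreathPerm Z Λ (1 : Fin p → Perm ℕ) 1 j = 1 := by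
  ext x
  rcases x with l | ⟨i, n, m⟩ <;> simp

lemma wreathPerm_mul (σ τ : Fin p → Perm ℕ)
    (u v : ∀ i : Fin p, ℕ → ∀ j : Fin q, Perm (Fin (Z j i))) (j : Fin q) :
    wreathPerm Z Λ σ u j * wreathPerm Z Λ τ v j =
      wreathPerm Z Λ (σ * τ) (fun i n => u i (τ i n) * v i n) j := by
  ext x
  rcases x with l | ⟨i, n, m⟩ <;> simp

lemma IsWreath.one (α : Fin p → ℕ) : IsWreath κ (Z := Z) α 1 1 where
  perm_finitary _ := one_mem _
  finite_support i := by simp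
  mem_inner i n := one_mem _
  perm_fix i n _ := rfl
  inner_fix i n _ := rfl

lemma IsWreath.mul {α : Fin p → ℕ} {σ τ : Fin p → Perm ℕ}
    {u v : ∀ i : Fin p, ℕ → ∀ j : Fin q, Perm (Fin (Z j i))}
    (h : IsWreath κ α σ u) (h' : IsWreath κ α τ v) :
    IsWreath κ α (σ * τ) (fun i n => u i (τ i n) * v i n) where
  perm_finitary i := mul_mem (h.perm_finitary i) (h'.perm_finitary i)
  finite_support i := by
    refine (((h.finite_support i).preimage (τ i).injective.injOn).union
      (h'.finite_support i)).subset fun n hn => ?_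
    by_contra hc
    simp only [Set.mem_union, Set.mem_preimage, Set.mem_ofPred_eq, not_or, not_not] at hc
    exact hn (by simp [hc.1, hc.2])
  mem_inner i n := mul_mem (h.mem_inner _ _) (h'.mem_inner _ _)
  perm_fix i n hn := by simp [h'.perm_fix i n hn, h.perm_fix i n hn]
  inner_fix i n hn := by simp [h'.perm_fix i n hn, h.inner_fix i n hn, h'.inner_fix i n hn]

lemma IsWreath.inv {α : Fin p → ℕ} {σ : Fin p → Perm ℕ}
    {u : ∀ i : Fin p, ℕ → ∀ j : Fin q, Perm (Fin (Z j i))} (h : IsWreath κ α σ u) :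
    IsWreath κ α σ⁻¹ (fun i n => (u i ((σ i)⁻¹ n))⁻¹) where
  perm_finitary i := inv_mem (h.perm_finitary i)
  finite_support i := by
    refine ((h.finite_support i).preimage (σ i)⁻¹.injective.injOn).subset fun n hn => ?_
    simpa using hn
  mem_inner i n := inv_mem (h.mem_inner _ _)
  perm_fix i n hn := (Perm.inv_eq_iff_eq).2 (h.perm_fix i n hn).symm
  inner_fix i n hn := by
    have : (σ i)⁻¹ n = n := (Perm.inv_eq_iff_eq).2 (h.perm_fix i n hn).symm
    simp only [this, h.inner_fix i n hn, inv_one]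

lemma wreathPerm_inv (σ : Fin p → Perm ℕ)
    (u : ∀ i : Fin p, ℕ → ∀ j : Fin q, Perm (Fin (Z j i))) (j : Fin q) :
    (wreathPerm Z Λ σ u j)⁻¹ = wreathPerm Z Λ σ⁻¹ (fun i n => (u i ((σ i)⁻¹ n))⁻¹) j := by
  rw [inv_eq_iff_mul_eq_one, wreathPerm_mul]
  ext x
  rcases x with l | ⟨i, n, m⟩ <;> simp

end Wreath

/-- The subgroup `K^α ⊂ G[Z, Λ]`, where `K` is `K^∘[Z]` or `K^⊛[Z]`; for `α = 0` this is `K`. -/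
def KSub (κ : PairKind) (Z : Matrix (Fin q) (Fin p) ℕ) (Λ : Fin q → ℕ) (α : Fin p → ℕ) :
    Subgroup (GGroup Z Λ) where
  carrier := {g | ∃ σ u, IsWreath κ α σ u ∧ ∀ j, (g j : Perm (Omega Z Λ j)) = wreathPerm Z Λ σ u j}
  one_mem' := ⟨1, 1, IsWreath.one α, fun j => (wreathPerm_one j).symm⟩
  mul_mem' := by
    rintro a b ⟨σ, u, h, ha⟩ ⟨τ, v, h', hb⟩
    exact ⟨_, _, h.mul h', fun j => by rw [← wreathPerm_mul, ← ha, ← hb]; rfl⟩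
  inv_mem' := by
    rintro a ⟨σ, u, h, ha⟩
    exact ⟨_, _, h.inv, fun j => by rw [← wreathPerm_inv, ← ha]; rfl⟩

/-- The permutation `Θ_N^{[a]}` of `ℕ`: it exchanges the blocks `a, …, a + N - 1` and
`a + N, …, a + 2N - 1` and fixes all other points. -/
def theta (a N : ℕ) : Perm ℕ :=
  Function.Involutive.toPerm
    (fun n => if n < a then n else if n < a + N then n + N else if n < a + 2 * N then n - N else n)
    (by intro n; dsimp only; split_ifs <;> omega)

lemma theta_apply (a N n : ℕ) : theta a N n =
    if n < a then n else if n < a + N then n + N else if n < a + 2 * N then n - N else n := rfl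

@[simp] lemma theta_theta (a N n : ℕ) : theta a N (theta a N n) = n := by
  simp only [theta_apply]; split_ifs <;> omega

lemma theta_mem (a N : ℕ) : theta a N ∈ finitary ℕ :=
  finite_nat_iff.2 ⟨a + 2 * N, fun n hn => by rw [theta_apply]; split_ifs <;> omega⟩

section Diag

variable {κ : PairKind} {Z : Matrix (Fin q) (Fin p) ℕ} {Λ : Fin q → ℕ}

lemma finite_cols (Z : Matrix (Fin q) (Fin p) ℕ) (Λ : Fin q → ℕ) (M : ℕ) (j : Fin q) :
    {x : Omega Z Λ j | ∀ i n m, x = Sum.inr ⟨i, n, m⟩ → n < M}.Finite := by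
  refine (Set.finite_range (Sum.map id (Sigma.map id fun _ => Prod.map Fin.val id) :
    Fin (Λ j) ⊕ (Σ i : Fin p, Fin M × Fin (Z j i)) → Omega Z Λ j)).subset ?_
  rintro (l | ⟨i, n, m⟩) hx
  · exact ⟨Sum.inl l, rfl⟩
  · exact ⟨Sum.inr ⟨i, ⟨n, hx i n m rfl⟩, m⟩, rfl⟩

/-- The diagonal embedding of `∏_i 𝕊_∞(ℕ_i)` into `G`. -/
def diag (Z : Matrix (Fin q) (Fin p) ℕ) (Λ : Fin q → ℕ) :
    (Fin p → finitary ℕ) →* GGroup Z Λ where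
  toFun σ := fun j => ⟨wreathPerm Z Λ (fun i => σ i) 1 j, by
    have : ∀ i, ∃ M, ∀ n, M ≤ n → (σ i : Perm ℕ) n = n := fun i => finite_nat_iff.1 (σ i).2
    choose M hM using this
    refine (finite_cols Z Λ (Finset.univ.sup M) j).subset ?_
    rintro x hx i n m rfl
    by_contra hn
    have h1 : M i ≤ n := (Finset.le_sup (Finset.mem_univ i)).trans (not_lt.1 hn)
    exact hx (by simp [hM i n h1])⟩
  map_one' := by
    funext j
    exact Subtype.ext (wreathPerm_one j)
  map_mul' σ τ := by
    funext j
    refine Subtype.ext ?_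
    change _ = wreathPerm Z Λ _ 1 j * wreathPerm Z Λ _ 1 j
    rw [wreathPerm_mul]
    congr 1

end Diag

/-- The element `Θ_N^{[α]} = (Θ_N^{[α_1]}, …, Θ_N^{[α_p]})` of `K ⊂ G`. -/
def Theta (Z : Matrix (Fin q) (Fin p) ℕ) (Λ : Fin q → ℕ) (α : Fin p → ℕ) (N : ℕ) : GGroup Z Λ :=
  diag Z Λ fun i => ⟨theta (α i) N, theta_mem (α i) N⟩

section Product

variable {κ : PairKind} {Z : Matrix (Fin q) (Fin p) ℕ} {Λ : Fin q → ℕ}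

lemma diag_mem {σ : Fin p → finitary ℕ} {α : Fin p → ℕ}
    (h : ∀ i n, n < α i → (σ i : Perm ℕ) n = n) : diag Z Λ σ ∈ KSub κ Z Λ α :=
  ⟨fun i => σ i, 1, ⟨fun i => (σ i).2, by simp, fun _ _ => one_mem _, h, fun _ _ _ => rfl⟩,
    fun _ => rfl⟩

lemma KSub_anti {α α' : Fin p → ℕ} (h : ∀ i, α i ≤ α' i) : KSub κ Z Λ α' ≤ KSub κ Z Λ α := by
  rintro g ⟨σ, u, hw, hg⟩
  exact ⟨σ, u, ⟨hw.1, hw.2, hw.3, fun i n hn => hw.4 i n (hn.trans_le (h i)),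
    fun i n hn => hw.5 i n (hn.trans_le (h i))⟩, hg⟩

/-- Every element of `G` commutes with `K^α` for large `α`. -/
lemma exists_commute (κ : PairKind) (g : GGroup Z Λ) :
    ∃ M, ∀ k ∈ KSub κ Z Λ fun _ => M, k * g = g * k := by
  have : ∀ j, ∃ M, ∀ i n m, M ≤ n →
      (g j : Perm (Omega Z Λ j)) (Sum.inr ⟨i, n, m⟩) = Sum.inr ⟨i, n, m⟩ := by
    intro j
    obtain ⟨M, hM⟩ := ((g j).2.image
      (Sum.elim (fun _ => 0) (fun x => x.2.1) : Omega Z Λ j → ℕ)).bddAbove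
    refine ⟨M + 1, fun i n m hn => ?_⟩
    by_contra hc
    have : n ≤ M := hM ⟨Sum.inr ⟨i, n, m⟩, hc, rfl⟩
    omega
  choose M hM using this
  refine ⟨Finset.univ.sup M, ?_⟩
  rintro k ⟨σ, u, hw, hk⟩
  funext j
  refine Subtype.ext ?_
  change (k j : Perm (Omega Z Λ j)) * (g j : Perm (Omega Z Λ j)) = g j * k j
  refine (Perm.Disjoint.commute fun x => ?_).eq
  rw [hk j]
  rcases x with l | ⟨i, n, m⟩
  · exact Or.inl rfl
  · by_cases hn : n < Finset.univ.sup M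
    · left
      simp [hw.perm_fix i n hn, hw.inner_fix i n hn]
    · right
      exact hM j i n m ((Finset.le_sup (Finset.mem_univ j)).trans (not_lt.1 hn))

lemma Theta_mem (β : Fin p → ℕ) (N : ℕ) : Theta Z Λ β N ∈ KSub κ Z Λ β :=
  diag_mem fun i n hn => by
    change theta _ _ n = n
    rw [theta_apply, if_pos hn]

lemma Theta_mul_self (β : Fin p → ℕ) (N : ℕ) : Theta Z Λ β N * Theta Z Λ β N = 1 := by
  rw [Theta, ← map_mul]
  convert map_one (diag Z Λ)
  funext i
  refine Subtype.ext (Equiv.ext fun n => ?_)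
  exact theta_theta _ _ n

lemma Theta_inv (β : Fin p → ℕ) (N : ℕ) : (Theta Z Λ β N)⁻¹ = Theta Z Λ β N :=
  inv_eq_of_mul_eq_one_left (Theta_mul_self β N)

/-- For large `N`, conjugation by `Θ_N^{[β]}` pushes a given element of `K^β` far away. -/
lemma exists_conj (β : Fin p → ℕ) {b : GGroup Z Λ} (hb : b ∈ KSub κ Z Λ β) :
    ∃ M, ∀ N, M ≤ N → Theta Z Λ β N * b * Theta Z Λ β N ∈ KSub κ Z Λ fun i => β i + N := by
  obtain ⟨σ, u, hw, hb⟩ := hb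
  have h1 : ∀ i, ∃ M, ∀ n, M ≤ n → σ i n = n := fun i => finite_nat_iff.1 (hw.perm_finitary i)
  have h2 : ∀ i, ∃ M, ∀ n, M ≤ n → u i n = 1 := fun i => finite_nat_iff.1 (hw.finite_support i)
  choose M hM using h1
  choose M' hM' using h2
  refine ⟨Finset.univ.sup M ⊔ Finset.univ.sup M', fun N hN => ?_⟩
  have e1 : ∀ i n, N ≤ n → σ i n = n := fun i n hn => hM i n <|
    ((Finset.le_sup (Finset.mem_univ i)).trans (le_sup_left.trans hN)).trans hn
  have e2 : ∀ i n, N ≤ n → u i n = 1 := fun i n hn => hM' i n <|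
    ((Finset.le_sup (Finset.mem_univ i)).trans (le_sup_right.trans hN)).trans hn
  have e3 : ∀ i n, n < β i + N → theta (β i) N n < β i ∨ N ≤ theta (β i) N n := by
    intro i n hn
    rw [theta_apply]; split_ifs <;> omega
  refine ⟨fun i => theta (β i) N * σ i * theta (β i) N, fun i n => u i (theta (β i) N n),
    ⟨?_, ?_, ?_, ?_, ?_⟩, ?_⟩
  · exact fun i => mul_mem (mul_mem (theta_mem _ _) (hw.1 i)) (theta_mem _ _)
  · exact fun i => (hw.2 i).preimage (theta (β i) N).injective.injOn
  · exact fun i n => hw.3 _ _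
  · intro i n hn
    have : σ i (theta (β i) N n) = theta (β i) N n :=
      (e3 i n hn).elim (hw.4 i _) (e1 i _)
    simp [this]
  · intro i n hn
    exact (e3 i n hn).elim (hw.5 i _) (e2 i _)
  · intro j
    change (wreathPerm Z Λ _ 1 j) * (b j : Perm (Omega Z Λ j)) * (wreathPerm Z Λ _ 1 j) = _
    rw [hb j, wreathPerm_mul, wreathPerm_mul]
    congr 1

lemma theta_step (a N : ℕ) : ∃ c d : finitary ℕ,
    (∀ n, n < a + N → (c : Perm ℕ) n = n) ∧ (∀ n, n < a + N → (d : Perm ℕ) n = n) ∧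
    theta a (N + 1) = d * theta a N * c := by
  let c : Perm ℕ :=
    { toFun := fun n => if n < a + N then n else if n = a + N then a + 2 * N else
        if n ≤ a + 2 * N then n - 1 else n
      invFun := fun n => if n < a + N then n else if n < a + 2 * N then n + 1 else
        if n = a + 2 * N then a + N else n
      left_inv := by intro n; dsimp only; split_ifs <;> omega
      right_inv := by intro n; dsimp only; split_ifs <;> omega }
  have hc : c ∈ finitary ℕ := finite_nat_iff.2 ⟨a + 2 * N + 1, fun n hn => by
    change (if n < a + N then n else if n = a + N then a + 2 * N else
        if n ≤ a + 2 * N then n - 1 else n) = n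
    split_ifs <;> omega⟩
  refine ⟨⟨c, hc⟩, ⟨theta a (N + 1) * c⁻¹ * theta a N,
    mul_mem (mul_mem (theta_mem _ _) (inv_mem hc)) (theta_mem _ _)⟩, ?_, ?_, ?_⟩
  · intro n hn
    change (if n < a + N then n else _) = n
    rw [if_pos hn]
  · intro n hn
    change theta a (N + 1) (if theta a N n < a + N then theta a N n else
      if theta a N n < a + 2 * N then theta a N n + 1 else
        if theta a N n = a + 2 * N then a + N else theta a N n) = n
    simp only [theta_apply]
    split_ifs <;> omega
  · ext n
    simp

/-- `Θ_{N'}^{[β]}` and `Θ_N^{[β]}` differ by elements of `K^{β + N}` on both sides. -/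
lemma Theta_le (κ : PairKind) (β : Fin p → ℕ) {N N' : ℕ} (h : N ≤ N') :
    ∃ k ∈ KSub κ Z Λ (fun i => β i + N), ∃ k' ∈ KSub κ Z Λ (fun i => β i + N),
      Theta Z Λ β N' = k * Theta Z Λ β N * k' := by
  induction N', h using Nat.le_induction with
  | base => exact ⟨1, one_mem _, 1, one_mem _, by simp⟩
  | succ N' hN ih =>
    obtain ⟨k, hk, k', hk', e⟩ := ih
    choose c d hc hd hcd using fun i => theta_step (β i) N'
    have hle : KSub κ Z Λ (fun i => β i + N') ≤ KSub κ Z Λ (fun i => β i + N) :=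
      KSub_anti fun i => by omega
    refine ⟨diag Z Λ d * k, mul_mem (hle (diag_mem hd)) hk,
      k' * diag Z Λ c, mul_mem hk' (hle (diag_mem hc)), ?_⟩
    have : Theta Z Λ β (N' + 1) = diag Z Λ d * Theta Z Λ β N' * diag Z Λ c := by
      rw [Theta, Theta, ← map_mul, ← map_mul]
      congr 1
      funext i
      exact Subtype.ext (hcd i)
    rw [this, e]
    group

lemma mk_eq_iff {A B : Subgroup (GGroup Z Λ)} {x y : GGroup Z Λ} :
    DoubleCoset.mk A B x = DoubleCoset.mk A B y ↔ ∃ a ∈ A, ∃ b ∈ B, y = a * x * b :=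
  Quotient.eq''.trans DoubleCoset.rel_iff

/-- The sequence of double cosets of `g Θ_N^{[β]} h` is eventually constant, and its limit does
not depend on the representatives `g`, `h`. -/
theorem exists_unique_limit {α β γ : Fin p → ℕ}
    (𝔤 : DoubleCoset.Quotient (KSub κ Z Λ γ : Set (GGroup Z Λ)) (KSub κ Z Λ β))
    (𝔥 : DoubleCoset.Quotient (KSub κ Z Λ β : Set (GGroup Z Λ)) (KSub κ Z Λ α)) :
    ∃! 𝔣 : DoubleCoset.Quotient (KSub κ Z Λ γ : Set (GGroup Z Λ)) (KSub κ Z Λ α),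
      ∀ g h : GGroup Z Λ, DoubleCoset.mk _ _ g = 𝔤 → DoubleCoset.mk _ _ h = 𝔥 →
        ∀ᶠ N in Filter.atTop, DoubleCoset.mk _ _ (g * Theta Z Λ β N * h) = 𝔣 := by
  obtain ⟨g₀, rfl⟩ := Quotient.exists_rep 𝔤
  obtain ⟨h₀, rfl⟩ := Quotient.exists_rep 𝔥
  -- stabilization for fixed representatives
  have stab : ∀ g h : GGroup Z Λ, ∃ M, ∀ N, M ≤ N →
      DoubleCoset.mk (KSub κ Z Λ γ) (KSub κ Z Λ α) (g * Theta Z Λ β N * h) =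
      DoubleCoset.mk (KSub κ Z Λ γ) (KSub κ Z Λ α) (g * Theta Z Λ β M * h) := by
    intro g h
    obtain ⟨M₁, h₁⟩ := exists_commute κ g
    obtain ⟨M₂, h₂⟩ := exists_commute κ h
    obtain ⟨M, hM⟩ : ∃ M, M = M₁ + M₂ + Finset.univ.sup α + Finset.univ.sup γ := ⟨_, rfl⟩
    refine ⟨M, fun N hN => ?_⟩
    obtain ⟨k, hk, k', hk', e⟩ := Theta_le (Z := Z) (Λ := Λ) κ β hN
    have hα : ∀ i, α i ≤ Finset.univ.sup α := fun i => Finset.le_sup (Finset.mem_univ i)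
    have hγ : ∀ i, γ i ≤ Finset.univ.sup γ := fun i => Finset.le_sup (Finset.mem_univ i)
    refine (mk_eq_iff.2 ⟨k, KSub_anti (fun i => ?_) hk, k', KSub_anti (fun i => ?_) hk', ?_⟩).symm
    · have := hγ i; omega
    · have := hα i; omega
    · have c₁ := h₁ k (KSub_anti (fun i => by omega) hk)
      have c₂ := h₂ k' (KSub_anti (fun i => by omega) hk')
      rw [e]
      calc g * (k * Theta Z Λ β M * k') * h = (g * k) * Theta Z Λ β M * (k' * h) := by group
        _ = _ := by rw [← c₁, c₂]; group
  -- independence of representatives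
  have indep : ∀ g h : GGroup Z Λ, ∀ b ∈ KSub κ Z Λ β, ∀ c ∈ KSub κ Z Λ β,
      ∀ᶠ N in Filter.atTop,
      DoubleCoset.mk (KSub κ Z Λ γ) (KSub κ Z Λ α) (g * b * Theta Z Λ β N * (c * h)) =
      DoubleCoset.mk (KSub κ Z Λ γ) (KSub κ Z Λ α) (g * Theta Z Λ β N * h) := by
    intro g h b hb c hc
    obtain ⟨M₁, h₁⟩ := exists_commute κ g
    obtain ⟨M₂, h₂⟩ := exists_commute κ (c * h)
    obtain ⟨M₃, h₃⟩ := exists_conj β hb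
    obtain ⟨M₄, h₄⟩ := exists_conj β hc
    have hα : ∀ i, α i ≤ Finset.univ.sup α := fun i => Finset.le_sup (Finset.mem_univ i)
    have hγ : ∀ i, γ i ≤ Finset.univ.sup γ := fun i => Finset.le_sup (Finset.mem_univ i)
    filter_upwards [Filter.eventually_ge_atTop
      (M₁ + M₂ + M₃ + M₄ + Finset.univ.sup α + Finset.univ.sup γ)] with N hN
    have hb' := h₃ N (by omega)
    have hc' := h₄ N (by omega)
    have c₁ := h₁ _ (KSub_anti (fun i => by omega) hc')
    have c₂ := h₂ _ (KSub_anti (fun i => by omega) hb')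
    have hT := Theta_mul_self (Z := Z) (Λ := Λ) β N
    refine (mk_eq_iff.2 ⟨_, KSub_anti (fun i => ?_) hc', _, KSub_anti (fun i => ?_) hb', ?_⟩).symm
    · have := hγ i; omega
    · have := hα i; omega
    · generalize Theta Z Λ β N = T at *
      have e1 : b * T = T * (T * b * T) := by
        rw [← mul_assoc, ← mul_assoc, hT, one_mul]
      have e2 : T * c = (T * c * T) * T := by
        rw [mul_assoc (T * c), hT, mul_one]
      calc g * b * T * (c * h) = g * (b * T) * (c * h) := by group
        _ = g * T * ((T * b * T) * (c * h)) := by rw [e1]; group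
        _ = g * (T * c) * h * (T * b * T) := by rw [c₂]; group
        _ = (g * (T * c * T)) * T * h * (T * b * T) := by
          conv_lhs => rw [e2]
          group
        _ = _ := by rw [← c₁]; group
  obtain ⟨M, hM⟩ := stab g₀ h₀
  refine ⟨DoubleCoset.mk _ _ (g₀ * Theta Z Λ β M * h₀), ?_, ?_⟩
  · intro g h hg hh
    obtain ⟨a, ha, b, hb, rfl⟩ := mk_eq_iff.1 hg.symm
    obtain ⟨c, hc, d, hd, rfl⟩ := mk_eq_iff.1 hh.symm
    filter_upwards [indep g₀ h₀ b hb c hc, Filter.eventually_ge_atTop M] with N hN hN'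
    rw [← hM N hN', ← hN]
    exact (mk_eq_iff.2 ⟨a, ha, d, hd, by group⟩).symm
  · intro 𝔣 h𝔣
    obtain ⟨N, hN, hN'⟩ := ((h𝔣 g₀ h₀ rfl rfl).and (Filter.eventually_ge_atTop M)).exists
    rw [← hN, hM N hN']

/-- The product `𝔤 ∘ 𝔥` of double cosets: the limit of the double cosets of
`g Θ_N^{[β]} h`, where `g ∈ 𝔤` and `h ∈ 𝔥`. -/
noncomputable def cosetMul {α β γ : Fin p → ℕ}
    (𝔤 : DoubleCoset.Quotient (KSub κ Z Λ γ : Set (GGroup Z Λ)) (KSub κ Z Λ β))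
    (𝔥 : DoubleCoset.Quotient (KSub κ Z Λ β : Set (GGroup Z Λ)) (KSub κ Z Λ α)) :
    DoubleCoset.Quotient (KSub κ Z Λ γ : Set (GGroup Z Λ)) (KSub κ Z Λ α) :=
  (exists_unique_limit 𝔤 𝔥).choose

lemma cosetMul_spec {α β γ : Fin p → ℕ} (g h : GGroup Z Λ) :
    ∀ᶠ N in Filter.atTop,
      DoubleCoset.mk (KSub κ Z Λ γ) (KSub κ Z Λ α) (g * Theta Z Λ β N * h) =
      cosetMul (DoubleCoset.mk (KSub κ Z Λ γ) (KSub κ Z Λ β) g)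
        (DoubleCoset.mk (KSub κ Z Λ β) (KSub κ Z Λ α) h) :=
  (exists_unique_limit _ _).choose_spec.1 g h rfl rfl

lemma cosetMul_eq {α β γ : Fin p → ℕ} {g h f : GGroup Z Λ} (N₀ : ℕ)
    (H : ∀ N, N₀ ≤ N → DoubleCoset.mk (KSub κ Z Λ γ) (KSub κ Z Λ α) (g * Theta Z Λ β N * h) =
      DoubleCoset.mk (KSub κ Z Λ γ) (KSub κ Z Λ α) f) :
    cosetMul (DoubleCoset.mk (KSub κ Z Λ γ) (KSub κ Z Λ β) g)
        (DoubleCoset.mk (KSub κ Z Λ β) (KSub κ Z Λ α) h) =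
      DoubleCoset.mk (KSub κ Z Λ γ) (KSub κ Z Λ α) f := by
  obtain ⟨N, hN, hN'⟩ :=
    ((cosetMul_spec (κ := κ) (α := α) (β := β) (γ := γ) g h).and
      (Filter.eventually_ge_atTop N₀)).exists
  rw [← hN, H N hN']

lemma cosetMul_eq_of_commute {α β γ : Fin p → ℕ} {g h : GGroup Z Λ} {W N₀ : ℕ}
    (hα : ∀ i, α i ≤ W) (hγ : ∀ i, γ i ≤ W) (hW : W ≤ N₀)
    (hg : ∀ k ∈ KSub κ Z Λ fun _ => W, k * g = g * k)
    (hh : ∀ k ∈ KSub κ Z Λ fun _ => W, k * h = h * k) :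
    cosetMul (DoubleCoset.mk (KSub κ Z Λ γ) (KSub κ Z Λ β) g)
        (DoubleCoset.mk (KSub κ Z Λ β) (KSub κ Z Λ α) h) =
      DoubleCoset.mk (KSub κ Z Λ γ) (KSub κ Z Λ α) (g * Theta Z Λ β N₀ * h) := by
  refine cosetMul_eq N₀ fun N hN => ?_
  obtain ⟨k, hk, k', hk', e⟩ := Theta_le (Z := Z) (Λ := Λ) κ β hN
  have c₁ := hg k (KSub_anti (fun i => by omega) hk)
  have c₂ := hh k' (KSub_anti (fun i => by omega) hk')
  refine (mk_eq_iff.2 ⟨k, KSub_anti (fun i => ?_) hk, k', KSub_anti (fun i => ?_) hk', ?_⟩).symm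
  · have := hγ i; omega
  · have := hα i; omega
  · rw [e]
    calc g * (k * Theta Z Λ β N₀ * k') * h = (g * k) * Theta Z Λ β N₀ * (k' * h) := by group
      _ = _ := by rw [← c₁, c₂]; group

lemma theta_cross {a c W M : ℕ} (ha : a ≤ W) (hc : c ≤ W) (hM : 10 * W ≤ M) :
    ∃ e d : finitary ℕ, (∀ n, n < W → (e : Perm ℕ) n = n) ∧ (∀ n, n < W → (d : Perm ℕ) n = n) ∧
      (∀ n, n < W → theta c (3 * W) ((d : Perm ℕ) (theta c (3 * W) n)) = n) ∧
      theta a M = d * theta a W * e := by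
  let f : ℕ → ℕ := fun n =>
    if a + W ≤ n ∧ n < a + 2 * W then n + (M - W) else
    if a + M ≤ n ∧ n < a + M + W then n - (M - W) else
    if c + 3 * W ≤ n ∧ n < c + 4 * W then n + M else
    if c + 3 * W + M ≤ n ∧ n < c + 4 * W + M then n - M else n
  have hf : Function.Involutive f := by
    intro n; simp only [f]; split_ifs <;> omega
  let e : Perm ℕ := hf.toPerm
  have he : ∀ n, e n = f n := fun n => rfl
  have hee : ∀ n, e (e n) = n := hf
  have hemem : e ∈ finitary ℕ := finite_nat_iff.2 ⟨c + 4 * W + M + a, fun n hn => by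
    rw [he]; simp only [f]; split_ifs <;> omega⟩
  have hd : ∀ n, n < W → theta a M (e (theta a W n)) = n := by
    intro n hn
    have h1 : theta a W n = if n < a then n else n + W := by
      rw [theta_apply]; split_ifs <;> omega
    rw [h1]
    by_cases h : n < a
    · rw [if_pos h, he]
      have : f n = n := by simp only [f]; split_ifs <;> omega
      rw [this, theta_apply, if_pos h]
    · rw [if_neg h, he]
      have : f (n + W) = n + M := by simp only [f]; split_ifs <;> omega
      rw [this, theta_apply]; split_ifs <;> omega
  refine ⟨⟨e, hemem⟩, ⟨theta a M * e * theta a W,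
    mul_mem (mul_mem (theta_mem _ _) hemem) (theta_mem _ _)⟩, ?_, ?_, ?_, ?_⟩
  · intro n hn
    change f n = n
    simp only [f]; split_ifs <;> omega
  · exact hd
  · intro n hn
    change theta c (3 * W) (theta a M (e (theta a W (theta c (3 * W) n)))) = n
    by_cases h : n < c
    · have h1 : theta c (3 * W) n = n := by rw [theta_apply, if_pos h]
      rw [h1, hd n hn, h1]
    · have h1 : theta c (3 * W) n = n + 3 * W := by rw [theta_apply]; split_ifs <;> omega
      have h2 : theta a W (n + 3 * W) = n + 3 * W := by rw [theta_apply]; split_ifs <;> omega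
      have h3 : f (n + 3 * W) = n + 3 * W + M := by simp only [f]; split_ifs <;> omega
      have h4 : theta a M (n + 3 * W + M) = n + 3 * W := by rw [theta_apply]; split_ifs <;> omega
      rw [h1, h2, he, h3, h4, ← h1, theta_theta]
  · ext n
    simp [hee]

theorem cosetMul_assoc {α β γ δ : Fin p → ℕ}
    (𝔤 : DoubleCoset.Quotient (KSub κ Z Λ δ : Set (GGroup Z Λ)) (KSub κ Z Λ γ))
    (𝔥 : DoubleCoset.Quotient (KSub κ Z Λ γ : Set (GGroup Z Λ)) (KSub κ Z Λ β))
    (𝔣 : DoubleCoset.Quotient (KSub κ Z Λ β : Set (GGroup Z Λ)) (KSub κ Z Λ α)) :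
    cosetMul (cosetMul 𝔤 𝔥) 𝔣 = cosetMul 𝔤 (cosetMul 𝔥 𝔣) := by
  obtain ⟨g, rfl⟩ := Quotient.exists_rep 𝔤
  obtain ⟨h, rfl⟩ := Quotient.exists_rep 𝔥
  obtain ⟨f, rfl⟩ := Quotient.exists_rep 𝔣
  change cosetMul (cosetMul (DoubleCoset.mk _ _ g) (DoubleCoset.mk _ _ h)) (DoubleCoset.mk _ _ f) =
    cosetMul (DoubleCoset.mk _ _ g) (cosetMul (DoubleCoset.mk _ _ h) (DoubleCoset.mk _ _ f))
  obtain ⟨M₁, h₁⟩ := exists_commute κ g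
  obtain ⟨M₂, h₂⟩ := exists_commute κ h
  obtain ⟨M₃, h₃⟩ := exists_commute κ f
  obtain ⟨W, hW⟩ : ∃ W, W = M₁ + M₂ + M₃ + Finset.univ.sup α + Finset.univ.sup β +
    Finset.univ.sup γ + Finset.univ.sup δ := ⟨_, rfl⟩
  have hα : ∀ i, α i ≤ W := fun i => by
    have : α i ≤ Finset.univ.sup α := Finset.le_sup (Finset.mem_univ i)
    omega
  have hβ : ∀ i, β i ≤ W := fun i => by
    have : β i ≤ Finset.univ.sup β := Finset.le_sup (Finset.mem_univ i)
    omega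
  have hγ : ∀ i, γ i ≤ W := fun i => by
    have : γ i ≤ Finset.univ.sup γ := Finset.le_sup (Finset.mem_univ i)
    omega
  have hδ : ∀ i, δ i ≤ W := fun i => by
    have : δ i ≤ Finset.univ.sup δ := Finset.le_sup (Finset.mem_univ i)
    omega
  have cg : ∀ k ∈ KSub κ Z Λ fun _ => W, k * g = g * k :=
    fun k hk => h₁ k (KSub_anti (fun i => by omega) hk)
  have ch : ∀ k ∈ KSub κ Z Λ fun _ => W, k * h = h * k :=
    fun k hk => h₂ k (KSub_anti (fun i => by omega) hk)
  have cf : ∀ k ∈ KSub κ Z Λ fun _ => W, k * f = f * k :=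
    fun k hk => h₃ k (KSub_anti (fun i => by omega) hk)
  rw [cosetMul_eq_of_commute (N₀ := 3 * W) hβ hδ (by omega) cg ch,
    cosetMul_eq_of_commute hα hγ le_rfl ch cf]
  set x := Theta Z Λ γ (3 * W) with hx
  set y := Theta Z Λ β W with hy
  trans DoubleCoset.mk (KSub κ Z Λ δ) (KSub κ Z Λ α) (g * x * h * y * f)
  · refine cosetMul_eq (10 * W) fun M hM => ?_
    choose e d he hd hxd hed using fun i => theta_cross (hβ i) (hγ i) hM
    have hdm : diag Z Λ d ∈ KSub κ Z Λ fun _ => W := diag_mem hd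
    have hem : diag Z Λ e ∈ KSub κ Z Λ fun _ => W := diag_mem he
    have hxm : x * diag Z Λ d * x ∈ KSub κ Z Λ fun _ => W := by
      rw [hx, Theta, ← map_mul, ← map_mul]
      exact diag_mem hxd
    have hy' : Theta Z Λ β M = diag Z Λ d * y * diag Z Λ e := by
      rw [hy, Theta, Theta, ← map_mul, ← map_mul]
      congr 1
      funext i
      exact Subtype.ext (hed i)
    have hT : x * x = 1 := Theta_mul_self γ _
    refine (mk_eq_iff.2 ⟨_, KSub_anti hδ hxm, _, KSub_anti hα hem, ?_⟩).symm
    have c₁ := cg _ hxm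
    have c₂ := ch _ hdm
    have c₃ := cf _ hem
    rw [hy']
    generalize diag Z Λ d = D at *
    generalize diag Z Λ e = E at *
    have e1 : x * D = x * D * x * x := by rw [mul_assoc (x * D), hT, mul_one]
    calc g * x * h * (D * y * E) * f = g * x * (h * D) * y * (E * f) := by group
      _ = g * (x * D) * h * y * (f * E) := by rw [← c₂, c₃]; group
      _ = (g * (x * D * x)) * x * h * y * (f * E) := by
        conv_lhs => rw [e1]
        group
      _ = _ := by rw [← c₁]; group
  · symm
    refine cosetMul_eq (3 * W) fun N hN => ?_
    obtain ⟨k, hk, k', hk', e⟩ := Theta_le (Z := Z) (Λ := Λ) κ γ hN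
    have c₁ := cg k (KSub_anti (fun i => by omega) hk)
    have c₂ := ch k' (KSub_anti (fun i => by omega) hk')
    have c₃ := cf k' (KSub_anti (fun i => by omega) hk')
    have c₄ : k' * y = y * k' := by
      obtain ⟨σ, u, hw, hk''⟩ := hk'
      funext j
      refine Subtype.ext ?_
      change (k' j : Perm (Omega Z Λ j)) * (y j : Perm (Omega Z Λ j)) = y j * k' j
      refine (Perm.Disjoint.commute fun z => ?_).eq
      rw [hk'' j]
      rcases z with l | ⟨i, n, m⟩
      · exact Or.inl rfl
      · by_cases hn : n < γ i + 3 * W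
        · left
          simp [hw.perm_fix i n hn, hw.inner_fix i n hn]
        · right
          have hb := hβ i
          have : theta (β i) W n = n := by rw [theta_apply]; split_ifs <;> omega
          change wreathPerm Z Λ (fun i => theta (β i) W) 1 j _ = _
          simp [this]
    refine (mk_eq_iff.2 ⟨k, KSub_anti (fun i => ?_) hk, k', KSub_anti (fun i => ?_) hk', ?_⟩).symm
    · have := hδ i; omega
    · have := hα i; omega
    · rw [e, ← hx]
      calc g * (k * x * k') * (h * y * f) = (g * k) * x * (k' * h) * y * f := by group
        _ = k * g * x * h * (k' * y) * f := by rw [← c₁, c₂]; group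
        _ = k * g * x * h * y * (k' * f) := by rw [c₄]; group
        _ = _ := by rw [c₃]; group

lemma one_cosetMul {α β : Fin p → ℕ}
    (𝔥 : DoubleCoset.Quotient (KSub κ Z Λ β : Set (GGroup Z Λ)) (KSub κ Z Λ α)) :
    cosetMul (DoubleCoset.mk (KSub κ Z Λ β) (KSub κ Z Λ β) 1) 𝔥 = 𝔥 := by
  obtain ⟨h, rfl⟩ := Quotient.exists_rep 𝔥
  exact cosetMul_eq 0 fun N _ =>
    (mk_eq_iff.2 ⟨_, Theta_mem β N, 1, one_mem _, by group⟩).symm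

lemma cosetMul_one {α β : Fin p → ℕ}
    (𝔥 : DoubleCoset.Quotient (KSub κ Z Λ β : Set (GGroup Z Λ)) (KSub κ Z Λ α)) :
    cosetMul 𝔥 (DoubleCoset.mk (KSub κ Z Λ α) (KSub κ Z Λ α) 1) = 𝔥 := by
  obtain ⟨h, rfl⟩ := Quotient.exists_rep 𝔥
  exact cosetMul_eq 0 fun N _ =>
    (mk_eq_iff.2 ⟨1, one_mem _, _, Theta_mem α N, by group⟩).symm

end Product

/-- The objects of the train `𝕋(G, K)`: multi-indices `α = (α_1, …, α_p)`. -/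
@[ext]
structure Train (κ : PairKind) (Z : Matrix (Fin q) (Fin p) ℕ) (Λ : Fin q → ℕ) : Type where
  idx : Fin p → ℕ

/-- The train `𝕋(G, K)`: morphisms `α → β` are the elements of `K^β \ G / K^α`. -/
noncomputable instance (κ : PairKind) (Z : Matrix (Fin q) (Fin p) ℕ) (Λ : Fin q → ℕ) :
    Category.{0} (Train κ Z Λ) where
  Hom α β := DoubleCoset.Quotient (KSub κ Z Λ β.idx : Set (GGroup Z Λ)) (KSub κ Z Λ α.idx)
  id _ := DoubleCoset.mk _ _ 1
  comp 𝔥 𝔤 := cosetMul 𝔤 𝔥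
  id_comp 𝔥 := cosetMul_one 𝔥
  comp_id 𝔥 := one_cosetMul 𝔥
  assoc 𝔣 𝔥 𝔤 := (cosetMul_assoc 𝔤 𝔥 𝔣).symm

section Reps

variable {κ : PairKind} {Z : Matrix (Fin q) (Fin p) ℕ} {Λ : Fin q → ℕ}

/-- The morphism `α → β` of the train which is the double coset of `g`. -/
def Train.coset (α β : Train κ Z Λ) (g : GGroup Z Λ) : α ⟶ β :=
  DoubleCoset.mk (KSub κ Z Λ β.idx) (KSub κ Z Λ α.idx) g

/-- The involution `𝔤 ↦ 𝔤^□` of the train, induced by `g ↦ g⁻¹`. -/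
def Train.square {α β : Train κ Z Λ} (𝔤 : α ⟶ β) : β ⟶ α :=
  Quotient.lift (s := DoubleCoset.setoid _ _) (fun g => Train.coset β α g⁻¹) (by
    intro a b hab
    obtain ⟨x, hx, y, hy, rfl⟩ := DoubleCoset.rel_iff.1 hab
    exact mk_eq_iff.2 ⟨y⁻¹, inv_mem hy, x⁻¹, inv_mem hx, by group⟩) 𝔤

section Fixed

variable {H : Type u} [NormedAddCommGroup H] [InnerProductSpace ℂ H]

/-- The subspace `H^α` of `K^α`-fixed vectors. -/
def fixedSubspace (ρ : GGroup Z Λ →* (H ≃ₗᵢ[ℂ] H)) (α : Train κ Z Λ) : Submodule ℂ H where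
  carrier := {v | ∀ k ∈ KSub κ Z Λ α.idx, ρ k v = v}
  zero_mem' := by simp
  add_mem' := by
    intro v w hv hw k hk
    rw [map_add, hv k hk, hw k hk]
  smul_mem' := by
    intro c v hv k hk
    rw [map_smul, hv k hk]

lemma isClosed_fixedSubspace (ρ : GGroup Z Λ →* (H ≃ₗᵢ[ℂ] H)) (α : Train κ Z Λ) :
    IsClosed (fixedSubspace ρ α : Set H) := by
  have : (fixedSubspace ρ α : Set H) = ⋂ k ∈ KSub κ Z Λ α.idx, {v | ρ k v = v} := by
    ext v
    simp [fixedSubspace]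
  rw [this]
  exact isClosed_biInter fun k _ => isClosed_eq (ρ k).continuous continuous_id

variable [CompleteSpace H]

instance (ρ : GGroup Z Λ →* (H ≃ₗᵢ[ℂ] H)) (α : Train κ Z Λ) :
    CompleteSpace (fixedSubspace ρ α) :=
  (isClosed_fixedSubspace ρ α).completeSpace_coe

/-- The operator `ρ̄_{α,β}(g) = P^β ρ(g) : H^α → H^β`, where `P^β` is the orthogonal projection
to `H^β`. -/
noncomputable def trainOp (ρ : GGroup Z Λ →* (H ≃ₗᵢ[ℂ] H)) (α β : Train κ Z Λ) (g : GGroup Z Λ) :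
    fixedSubspace ρ α →L[ℂ] fixedSubspace ρ β :=
  (fixedSubspace ρ β).orthogonalProjectionOnto ∘L
    ((ρ g).toContinuousLinearEquiv : H →L[ℂ] H) ∘L (fixedSubspace ρ α).subtypeL

/-- `ρ̄_{α,β}(g)` depends only on the double coset of `g`. -/
lemma trainOp_eq (ρ : GGroup Z Λ →* (H ≃ₗᵢ[ℂ] H)) (α β : Train κ Z Λ) {g g' : GGroup Z Λ}
    (h : DoubleCoset.setoid (KSub κ Z Λ β.idx : Set (GGroup Z Λ)) (KSub κ Z Λ α.idx) g g') :
    trainOp ρ α β g = trainOp ρ α β g' := by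
  obtain ⟨a, ha, b, hb, rfl⟩ := DoubleCoset.rel_iff.1 h
  ext v
  have hv : ρ b v = v := v.2 b hb
  have e : ρ (a * g * b) v = ρ a (ρ g v) := by
    rw [map_mul, map_mul]
    change ρ a (ρ g (ρ b v)) = _
    rw [hv]
  refine congrArg Subtype.val (?_ : (fixedSubspace ρ β).orthogonalProjectionOnto (ρ g v) =
    (fixedSubspace ρ β).orthogonalProjectionOnto (ρ (a * g * b) v))
  rw [e, ← sub_eq_zero, ← map_sub, Submodule.orthogonalProjectionOnto_eq_zero_iff,
    Submodule.mem_orthogonal]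
  intro w hw
  rw [inner_sub_right, sub_eq_zero]
  conv_rhs => rw [← hw a ha]
  rw [LinearIsometryEquiv.inner_map_map]

end Fixed

/-- A unitary representation of `G` in a (complex) Hilbert space which is `K`-admissible: the
union of the subspaces `H^α` is dense. -/
structure AdmissibleRep (κ : PairKind) (Z : Matrix (Fin q) (Fin p) ℕ) (Λ : Fin q → ℕ) :
    Type (u + 1) where
  H : Type u
  [normedAddCommGroup : NormedAddCommGroup H]
  [innerProductSpace : InnerProductSpace ℂ H]
  [completeSpace : CompleteSpace H]
  ρ : GGroup Z Λ →* (H ≃ₗᵢ[ℂ] H)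
  admissible : Dense (⋃ α : Train κ Z Λ, (fixedSubspace ρ α : Set H))

attribute [instance] AdmissibleRep.normedAddCommGroup AdmissibleRep.innerProductSpace
  AdmissibleRep.completeSpace

/-- Unitary equivalence of `K`-admissible representations of `G`. -/
instance AdmissibleRep.setoid (κ : PairKind) (Z : Matrix (Fin q) (Fin p) ℕ) (Λ : Fin q → ℕ) :
    Setoid (AdmissibleRep.{u} κ Z Λ) where
  r π π' := ∃ U : π.H ≃ₗᵢ[ℂ] π'.H, ∀ g v, U (π.ρ g v) = π'.ρ g (U v)
  iseqv :=
    { refl := fun π => ⟨LinearIsometryEquiv.refl ℂ _, fun _ _ => rfl⟩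
      symm := by
        rintro π π' ⟨U, hU⟩
        refine ⟨U.symm, fun g v => ?_⟩
        rw [LinearIsometryEquiv.symm_apply_eq, hU, LinearIsometryEquiv.apply_symm_apply]
      trans := by
        rintro π π' π'' ⟨U, hU⟩ ⟨U', hU'⟩
        refine ⟨U.trans U', fun g v => ?_⟩
        simp [hU, hU'] }

/-- A family of Hilbert spaces `V_α` indexed by the objects of the train, with a bounded operator
`V_α → V_β` for every morphism `α → β`. -/
structure OperatorFamily (κ : PairKind) (Z : Matrix (Fin q) (Fin p) ℕ) (Λ : Fin q → ℕ) :
    Type (u + 1) where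
  V : Train κ Z Λ → Type u
  [normedAddCommGroup : ∀ α, NormedAddCommGroup (V α)]
  [innerProductSpace : ∀ α, InnerProductSpace ℂ (V α)]
  [completeSpace : ∀ α, CompleteSpace (V α)]
  map : ∀ {α β : Train κ Z Λ}, (α ⟶ β) → (V α →L[ℂ] V β)

attribute [instance] OperatorFamily.normedAddCommGroup OperatorFamily.innerProductSpace
  OperatorFamily.completeSpace

/-- The family is a `*`-representation of the train (a functor compatible with the involution)
by operators of norm at most `1`. -/
structure OperatorFamily.IsContractiveStarRep (T : OperatorFamily.{u} κ Z Λ) : Prop where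
  map_id : ∀ α, T.map (𝟙 α) = ContinuousLinearMap.id ℂ (T.V α)
  map_comp : ∀ {α β γ : Train κ Z Λ} (𝔥 : α ⟶ β) (𝔤 : β ⟶ γ),
    T.map (𝔥 ≫ 𝔤) = T.map 𝔤 ∘L T.map 𝔥
  map_square : ∀ {α β : Train κ Z Λ} (𝔤 : α ⟶ β),
    T.map (Train.square 𝔤) = ContinuousLinearMap.adjoint (T.map 𝔤)
  norm_le_one : ∀ {α β : Train κ Z Λ} (𝔤 : α ⟶ β), ‖T.map 𝔤‖ ≤ 1

/-- The `*`-representations of the train by contractions. -/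
def StarRep (κ : PairKind) (Z : Matrix (Fin q) (Fin p) ℕ) (Λ : Fin q → ℕ) : Type (u + 1) :=
  {T : OperatorFamily.{u} κ Z Λ // T.IsContractiveStarRep}

/-- Unitary equivalence of `*`-representations of the train. -/
instance StarRep.setoid (κ : PairKind) (Z : Matrix (Fin q) (Fin p) ℕ) (Λ : Fin q → ℕ) :
    Setoid (StarRep.{u} κ Z Λ) where
  r T T' := ∃ U : ∀ α, T.1.V α ≃ₗᵢ[ℂ] T'.1.V α, ∀ (α β : Train κ Z Λ) (𝔤 : α ⟶ β) (v : T.1.V α),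
    U β (T.1.map 𝔤 v) = T'.1.map 𝔤 (U α v)
  iseqv :=
    { refl := fun T => ⟨fun _ => LinearIsometryEquiv.refl ℂ _, fun _ _ _ _ => rfl⟩
      symm := by
        rintro T T' ⟨U, hU⟩
        refine ⟨fun α => (U α).symm, fun α β 𝔤 v => ?_⟩
        rw [LinearIsometryEquiv.symm_apply_eq, hU, LinearIsometryEquiv.apply_symm_apply]
      trans := by
        rintro T T' T'' ⟨U, hU⟩ ⟨U', hU'⟩
        refine ⟨fun α => (U α).trans (U' α), fun α β 𝔤 v => ?_⟩
        simp [hU, hU'] }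

/-- The family of the subspaces `H^α` and the operators `ρ̄_{α,β}(𝔤) : H^α → H^β` constructed from
a `K`-admissible unitary representation of `G`. -/
noncomputable def AdmissibleRep.train (π : AdmissibleRep.{u} κ Z Λ) : OperatorFamily.{u} κ Z Λ where
  V α := fixedSubspace π.ρ α
  map {α β} 𝔤 := Quotient.lift (s := DoubleCoset.setoid _ _) (trainOp π.ρ α β)
    (fun _ _ h => trainOp_eq π.ρ α β h) 𝔤

end Reps

end SymTrain

namespace SymTrain

open Equiv CategoryTheory Filter Topology ComplexConjugate

/-! ### Hilbert spaces generated by a family of vectors with prescribed Gram kernel. -/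

section Hilbert

/-! The analytic heart is `tendsto_inner_Theta`: in an admissible representation the unitaries
$\rho(\Theta_N^{[\beta]})$ converge weakly to $P^\beta$. They fix $H^\beta$; and for $b\in K^\beta$
they send $\rho(b)x-x$ weakly to $0$, because $\Theta_N b\,\Theta_N$ lies so deep in $K$ that it
fixes any given vector of $\bigcup_\gamma H^\gamma$. Hence $P^\gamma\rho(g\Theta_N h)$ tends weakly
on $H^\alpha$ to $P^\gamma\rho(g)P^\beta\rho(h)$, while its double coset is eventually the product.
This gives multiplicativity (`trainOp_comp`).

Injectivity: for $v\in H^\alpha$, $w\in H^\beta$ the operators $\overline\rho_{\alpha,\beta}$ know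
every coefficient $\langle\rho(g)v,w\rangle$, and such vectors are dense, so $\rho$ can be
recovered.

Surjectivity is a GNS construction. Given $T$, the symbols $\rho(g)v$ with $v\in V_\alpha$ get the
inner products $\langle\rho(g)v,\rho(h)w\rangle=\langle T(h^{-1}g)v,w\rangle$. If $K^\gamma$
commutes with $g$ and $\gamma\ge\alpha$, the coset of $h^{-1}g$ factors through $\gamma$, so this
number is $\langle T(g)v,T(h)w\rangle$ in $V_\gamma$ (`orbitKernel_eq_inner`). One $\gamma$ serves
any finite set of symbols, whence positivity. Left translation gives $\rho$, and $V_\alpha$ embeds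
in $H^\alpha$. Weak convergence of $\Theta_N^{[\alpha]}$ shows that $P^\alpha$ carries each
$V_\gamma$ into $V_\alpha$ (`projection_embedding`), so $H^\alpha$ is no larger than $V_\alpha$. -/

lemma eq_of_inner_eq_of_dense_span {X H : Type*} [NormedAddCommGroup H] [InnerProductSpace ℂ H]
    {a : X → H} (ha : Dense (Submodule.span ℂ (Set.range a) : Set H)) {v w : H}
    (h : ∀ x, inner ℂ v (a x) = inner ℂ w (a x)) : v = w := by
  refine ha.eq_of_inner_left ℂ fun y hy => ?_
  induction hy using Submodule.span_induction with
  | mem y hy =>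
    obtain ⟨x, rfl⟩ := hy
    exact h x
  | zero => simp
  | add y z _ _ hy hz => rw [inner_add_right, inner_add_right, hy, hz]
  | smul c y _ hy => rw [inner_smul_right, inner_smul_right, hy]

/-- Two families of vectors with dense spans and equal Gram matrices are unitarily equivalent. -/
theorem exists_isometryEquiv_of_inner_eq {X H H' : Type*}
    [NormedAddCommGroup H] [InnerProductSpace ℂ H] [CompleteSpace H]
    [NormedAddCommGroup H'] [InnerProductSpace ℂ H'] [CompleteSpace H']
    (a : X → H) (b : X → H') (ha : Dense (Submodule.span ℂ (Set.range a) : Set H))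
    (hb : Dense (Submodule.span ℂ (Set.range b) : Set H'))
    (hab : ∀ x y, inner ℂ (a x) (a y) = inner ℂ (b x) (b y)) :
    ∃ U : H ≃ₗᵢ[ℂ] H', ∀ x, U (a x) = b x := by
  have ha' : DenseRange (Finsupp.linearCombination ℂ a) := by
    rwa [DenseRange, ← LinearMap.coe_range, Finsupp.range_linearCombination]
  have hb' : DenseRange (Finsupp.linearCombination ℂ b) := by
    rwa [DenseRange, ← LinearMap.coe_range, Finsupp.range_linearCombination]
  -- The unitary is induced by the identity of `X →₀ ℂ`: equal Gram matrices give each formal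
  -- combination the same norm in both spaces, so linear independence is not needed.
  have hn : ∀ f, ‖Finsupp.linearCombination ℂ b (LinearEquiv.refl ℂ (X →₀ ℂ) f)‖ =
      ‖Finsupp.linearCombination ℂ a f‖ := by
    intro f
    rw [@norm_eq_sqrt_re_inner ℂ, @norm_eq_sqrt_re_inner ℂ]
    congr 2
    simp only [LinearEquiv.refl_apply, Finsupp.linearCombination_apply, Finsupp.sum_inner,
      Finsupp.inner_sum, inner_smul_left, inner_smul_right, hab]
  refine ⟨(LinearEquiv.refl ℂ (X →₀ ℂ)).extendOfIsometry _ _ ha' hb' hn, fun x => ?_⟩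
  have := LinearEquiv.extendOfIsometry_eq (LinearEquiv.refl ℂ (X →₀ ℂ)) _ _ ha' hb' hn
    (Finsupp.single x 1)
  simpa using this

/-- The positive semidefinite form on finitely supported functions given by a kernel which is a
Gram kernel on every finite set. -/
noncomputable abbrev kernelCore {X : Type u} (k : X → X → ℂ)
    (hk : ∀ s : Finset X, ∃ (E : Type u) (_ : NormedAddCommGroup E) (_ : InnerProductSpace ℂ E)
      (φ : X → E), ∀ x ∈ s, ∀ y ∈ s, k x y = inner ℂ (φ x) (φ y)) :
    PreInnerProductSpace.Core ℂ (X →₀ ℂ) where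
  inner f g := f.sum fun x z => g.sum fun y w => conj z * w * k x y
  conj_inner_symm f g := by
    classical
    have hsymm : ∀ x y, conj (k x y) = k y x := by
      intro x y
      obtain ⟨E, _, _, φ, h⟩ := hk {x, y}
      rw [h x (by simp) y (by simp), h y (by simp) x (by simp), inner_conj_symm]
    rw [Finsupp.sum_comm]
    simp only [map_finsuppSum, map_mul, RingHomCompTriple.comp_apply, RingHom.id_apply, hsymm]
    refine Finsupp.sum_congr fun x _ => Finsupp.sum_congr fun y _ => ?_
    ring
  re_inner_nonneg f := by
    obtain ⟨E, _, _, φ, h⟩ := hk f.support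
    have : (f.sum fun x z => f.sum fun y w => conj z * w * k x y) =
        inner ℂ (f.sum fun x z => z • φ x) (f.sum fun x z => z • φ x) := by
      simp only [Finsupp.sum_inner, Finsupp.inner_sum, inner_smul_left, inner_smul_right]
      rw [Finsupp.sum_comm]
      refine Finsupp.sum_congr fun y hy => ?_
      rw [Finsupp.mul_sum]
      refine Finsupp.sum_congr fun x hx => ?_
      rw [h x hx y hy]
      ring
    rw [this]
    exact inner_self_nonneg
  add_left f g h := by
    rw [Finsupp.sum_add_index'] <;> simp [← Finsupp.sum_add, add_mul]
  smul_left f g r := by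
    rw [Finsupp.sum_smul_index] <;> simp [Finsupp.mul_sum, ← mul_assoc]

/-- A kernel which is a Gram kernel on every finite set is the Gram kernel of a total family of
vectors in a Hilbert space. -/
theorem exists_hilbert_of_kernel {X : Type u} (k : X → X → ℂ)
    (hk : ∀ s : Finset X, ∃ (E : Type u) (_ : NormedAddCommGroup E) (_ : InnerProductSpace ℂ E)
      (φ : X → E), ∀ x ∈ s, ∀ y ∈ s, k x y = inner ℂ (φ x) (φ y)) :
    ∃ (H : Type u) (_ : NormedAddCommGroup H) (_ : InnerProductSpace ℂ H) (_ : CompleteSpace H)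
      (a : X → H), (∀ x y, inner ℂ (a x) (a y) = k x y) ∧
        Dense (Submodule.span ℂ (Set.range a) : Set H) := by
  -- The form may be degenerate; the completion of the seminormed space also identifies vectors at
  -- distance zero.
  let _ : PreInnerProductSpace.Core ℂ (X →₀ ℂ) := kernelCore k hk
  let _ : SeminormedAddCommGroup (X →₀ ℂ) :=
    InnerProductSpace.Core.toSeminormedAddCommGroup (𝕜 := ℂ)
  let _ : InnerProductSpace ℂ (X →₀ ℂ) := .ofCore _
  refine ⟨UniformSpace.Completion (X →₀ ℂ), inferInstance, inferInstance, inferInstance,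
    fun x => ((Finsupp.single x 1 : X →₀ ℂ) : UniformSpace.Completion (X →₀ ℂ)), ?_, ?_⟩
  · intro x y
    rw [UniformSpace.Completion.inner_coe]
    change (Finsupp.sum (Finsupp.single x 1) fun x z =>
      Finsupp.sum (Finsupp.single y 1) fun y w => conj z * w * k x y) = k x y
    simp
  · refine UniformSpace.Completion.denseRange_coe.mono ?_
    rintro _ ⟨f, rfl⟩
    induction f using Finsupp.induction_linear with
    | zero => exact Submodule.zero_mem _
    | add f g hf hg =>
      rw [UniformSpace.Completion.coe_add]
      exact Submodule.add_mem _ hf hg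
    | single x c =>
      have : (Finsupp.single x c : X →₀ ℂ) = c • Finsupp.single x 1 := by simp
      rw [this, UniformSpace.Completion.coe_smul]
      exact Submodule.smul_mem _ _ (Submodule.subset_span ⟨x, rfl⟩)

end Hilbert

/-! ### From admissible representations to representations of the train. -/

section Forward

variable {p q : ℕ} {κ : PairKind} {Z : Matrix (Fin q) (Fin p) ℕ} {Λ : Fin q → ℕ}
variable {H : Type u} [NormedAddCommGroup H] [InnerProductSpace ℂ H]

lemma rep_mul_apply (ρ : GGroup Z Λ →* (H ≃ₗᵢ[ℂ] H)) (g h : GGroup Z Λ) (v : H) :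
    ρ (g * h) v = ρ g (ρ h v) := by
  rw [map_mul]; rfl

lemma rep_inv_apply_apply (ρ : GGroup Z Λ →* (H ≃ₗᵢ[ℂ] H)) (g : GGroup Z Λ) (v : H) :
    ρ g⁻¹ (ρ g v) = v := by
  rw [← rep_mul_apply, inv_mul_cancel, map_one]; rfl

lemma inner_rep_left (ρ : GGroup Z Λ →* (H ≃ₗᵢ[ℂ] H)) (g : GGroup Z Λ) (v w : H) :
    inner ℂ (ρ g v) w = inner ℂ v (ρ g⁻¹ w) := by
  rw [← LinearIsometryEquiv.inner_map_map (ρ g⁻¹), rep_inv_apply_apply]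

lemma fixedSubspace_mono (ρ : GGroup Z Λ →* (H ≃ₗᵢ[ℂ] H)) {α β : Train κ Z Λ}
    (h : ∀ i, α.idx i ≤ β.idx i) : fixedSubspace ρ α ≤ fixedSubspace ρ β :=
  fun _ hv k hk => hv k (KSub_anti h hk)

/-- A vector in the span of the union of the subspaces `H^α` belongs to one of them. -/
lemma exists_mem_fixedSubspace_of_mem_span (ρ : GGroup Z Λ →* (H ≃ₗᵢ[ℂ] H)) {v : H}
    (hv : v ∈ Submodule.span ℂ (⋃ α : Train κ Z Λ, (fixedSubspace ρ α : Set H))) :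
    ∃ α : Train κ Z Λ, v ∈ fixedSubspace ρ α := by
  induction hv using Submodule.span_induction with
  | mem x hx => simpa using hx
  | zero => exact ⟨⟨0⟩, Submodule.zero_mem _⟩
  | add x y _ _ hx hy =>
    obtain ⟨α, hα⟩ := hx
    obtain ⟨β, hβ⟩ := hy
    refine ⟨⟨α.idx ⊔ β.idx⟩, Submodule.add_mem _ (fixedSubspace_mono ρ (fun i => ?_) hα)
      (fixedSubspace_mono ρ (fun i => ?_) hβ)⟩
    · exact le_max_left _ _
    · exact le_max_right _ _
  | smul c x _ hx =>
    obtain ⟨α, hα⟩ := hx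
    exact ⟨α, Submodule.smul_mem _ c hα⟩

/-- Uniformly bounded sequences of vectors and weak convergence: testing against a dense set is
enough. -/
lemma tendsto_inner_zero_of_dense {x : ℕ → H} {C : ℝ} (hx : ∀ N, ‖x N‖ ≤ C) {s : Set H}
    (hs : Dense s) (h : ∀ w ∈ s, Tendsto (fun N => inner ℂ (x N) w) atTop (𝓝 0)) (w : H) :
    Tendsto (fun N => inner ℂ (x N) w) atTop (𝓝 0) := by
  have hC : 0 ≤ C := (norm_nonneg _).trans (hx 0)
  rw [Metric.tendsto_atTop]
  intro ε hε
  -- `C + 1` rather than `C` keeps the denominator positive when `C = 0`.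
  obtain ⟨w', hw', hd⟩ := hs.exists_dist_lt w (show 0 < ε / (2 * (C + 1)) by positivity)
  obtain ⟨N₀, hN₀⟩ := Metric.tendsto_atTop.1 (h w' hw') (ε / 2) (by positivity)
  refine ⟨N₀, fun N hN => ?_⟩
  have h1 := hN₀ N hN
  rw [dist_zero_right] at h1 ⊢
  have h2 : inner ℂ (x N) w = inner ℂ (x N) w' + inner ℂ (x N) (w - w') := by
    rw [inner_sub_right]; ring
  have h3 : ‖inner ℂ (x N) (w - w')‖ ≤ (C + 1) * (ε / (2 * (C + 1))) := by
    refine (norm_inner_le_norm _ _).trans ?_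
    rw [← dist_eq_norm]
    exact mul_le_mul ((hx N).trans (by linarith)) hd.le dist_nonneg (by positivity)
  have h4 : (C + 1) * (ε / (2 * (C + 1))) = ε / 2 := by field_simp
  rw [h2]
  refine (norm_add_le _ _).trans_lt ?_
  linarith

/-- The vectors sent weakly to `0` by a sequence of unitary operators form a closed set. -/
lemma isClosed_weakNull (u : ℕ → H ≃ₗᵢ[ℂ] H) :
    IsClosed {v : H | ∀ w, Tendsto (fun N => inner ℂ (u N v) w) atTop (𝓝 0)} := by
  refine isClosed_of_closure_subset fun v hv w => ?_
  rw [Metric.tendsto_atTop]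
  intro ε hε
  obtain ⟨v', hv', hd⟩ := Metric.mem_closure_iff.1 hv (ε / (2 * (‖w‖ + 1))) (by positivity)
  obtain ⟨N₀, hN₀⟩ := Metric.tendsto_atTop.1 (hv' w) (ε / 2) (by positivity)
  refine ⟨N₀, fun N hN => ?_⟩
  have h1 := hN₀ N hN
  rw [dist_zero_right] at h1 ⊢
  have h2 : inner ℂ (u N v) w = inner ℂ (u N v') w + inner ℂ (u N (v - v')) w := by
    rw [map_sub, inner_sub_left]; ring
  have h3 : ‖inner ℂ (u N (v - v')) w‖ ≤ ε / (2 * (‖w‖ + 1)) * (‖w‖ + 1) := by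
    refine (norm_inner_le_norm _ _).trans ?_
    rw [LinearIsometryEquiv.norm_map, ← dist_eq_norm]
    exact mul_le_mul hd.le (by linarith) (norm_nonneg _) (by positivity)
  have h4 : ε / (2 * (‖w‖ + 1)) * (‖w‖ + 1) = ε / 2 := by field_simp
  rw [h2]
  refine (norm_add_le _ _).trans_lt ?_
  linarith

/-- For `b ∈ K^β` and vectors fixed by some `K^α`, the operator `ρ(b)` is not seen by
`ρ(Θ_N^{[β]})` for large `N`. -/
lemma eventually_inner_Theta_apply (ρ : GGroup Z Λ →* (H ≃ₗᵢ[ℂ] H)) {β γ : Train κ Z Λ}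
    {b : GGroup Z Λ} (hb : b ∈ KSub κ Z Λ β.idx) {x w : H} (hw : w ∈ fixedSubspace ρ γ) :
    ∀ᶠ N in atTop, inner ℂ (ρ (Theta Z Λ β.idx N) (ρ b x)) w =
      inner ℂ (ρ (Theta Z Λ β.idx N) x) w := by
  obtain ⟨M, hM⟩ := exists_conj β.idx hb
  filter_upwards [eventually_ge_atTop (M + Finset.univ.sup γ.idx)] with N hN
  have hk := hM N (by omega)
  have hγ : ∀ i, γ.idx i ≤ β.idx i + N := fun i => by
    have : γ.idx i ≤ Finset.univ.sup γ.idx := Finset.le_sup (Finset.mem_univ i)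
    omega
  -- As $\Theta_N$ is an involution, $b$ can be moved to its left as $\Theta_N b\,\Theta_N\in
  -- K^{\beta+N}$, whose inverse fixes `w` once $\beta+N\ge\gamma$.
  have e : Theta Z Λ β.idx N * b =
      (Theta Z Λ β.idx N * b * Theta Z Λ β.idx N) * Theta Z Λ β.idx N := by
    rw [mul_assoc (Theta Z Λ β.idx N * b), Theta_mul_self, mul_one]
  rw [← rep_mul_apply, e, rep_mul_apply, inner_rep_left, hw _ (inv_mem (KSub_anti hγ hk))]

variable [CompleteSpace H]

/-- In an admissible representation the operators `ρ(Θ_N^{[β]})` converge weakly to the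
orthogonal projection to `H^β`. -/
theorem tendsto_inner_Theta (ρ : GGroup Z Λ →* (H ≃ₗᵢ[ℂ] H))
    (hρ : Dense (⋃ α : Train κ Z Λ, (fixedSubspace ρ α : Set H))) (β : Train κ Z Λ) (v w : H) :
    Tendsto (fun N => inner ℂ (ρ (Theta Z Λ β.idx N) v) w) atTop
      (𝓝 (inner ℂ ((fixedSubspace ρ β).orthogonalProjectionOnto v : H) w)) := by
  let S : Submodule ℂ H :=
    { carrier := {v | ∀ w, Tendsto (fun N => inner ℂ (ρ (Theta Z Λ β.idx N) v) w) atTop (𝓝 0)}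
      zero_mem' := by simp
      add_mem' := by
        intro a b ha hb w
        simpa [inner_add_left] using (ha w).add (hb w)
      smul_mem' := by
        intro c a ha w
        simpa [inner_smul_left] using (ha w).mul_const (conj c) }
  have hS : IsClosed (S : Set H) := isClosed_weakNull fun N => ρ (Theta Z Λ β.idx N)
  have : CompleteSpace S := hS.completeSpace_coe
  -- `S` contains every $\rho(b^{-1})x-x$ with $b\in K^\beta$, and a vector orthogonal to all of
  -- these is fixed by $b$.
  have hSβ : Sᗮ ≤ fixedSubspace ρ β := by
    intro y hy b hb
    refine ext_inner_left ℂ fun x => ?_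
    have hx : ρ b⁻¹ x - x ∈ S := by
      refine fun w => tendsto_inner_zero_of_dense (C := ‖ρ b⁻¹ x - x‖)
        (fun N => (LinearIsometryEquiv.norm_map _ _).le) hρ (fun w hw => ?_) w
      obtain ⟨γ, hγ⟩ := Set.mem_iUnion.1 hw
      refine tendsto_const_nhds.congr' ?_
      filter_upwards [eventually_inner_Theta_apply ρ (inv_mem hb) (x := x) hγ] with N hN
      rw [map_sub, inner_sub_left, hN, sub_self]
    have h0 := Submodule.inner_right_of_mem_orthogonal hx hy
    rwa [inner_sub_left, sub_eq_zero, inner_rep_left, inv_inv] at h0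
  -- Closedness of `S` makes it equal to its double orthogonal complement.
  have hβS : (fixedSubspace ρ β)ᗮ ≤ S := by
    have := Submodule.orthogonal_le hSβ
    rwa [Submodule.orthogonal_orthogonal] at this
  set P := (fixedSubspace ρ β).orthogonalProjectionOnto v
  have h0 : Tendsto (fun N => inner ℂ (ρ (Theta Z Λ β.idx N) (v - P)) w) atTop (𝓝 0) :=
    hβS (Submodule.sub_starProjection_mem_orthogonal (K := fixedSubspace ρ β) v) w
  have h1 := h0.add_const (inner ℂ (P : H) w)
  rw [zero_add] at h1
  refine h1.congr fun N => ?_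
  rw [map_sub, inner_sub_left, P.2 _ (Theta_mem _ _), sub_add_cancel]

/-- Against a vector of $H^\beta$ the projection $P^\beta$ is invisible. Identities between train
operators thus become identities between matrix coefficients of $\rho$. -/
lemma inner_trainOp (ρ : GGroup Z Λ →* (H ≃ₗᵢ[ℂ] H)) {α β : Train κ Z Λ} (g : GGroup Z Λ)
    (v : fixedSubspace ρ α) (w : fixedSubspace ρ β) :
    inner ℂ (trainOp ρ α β g v) w = inner ℂ (ρ g (v : H)) (w : H) :=
  Submodule.inner_orthogonalProjectionOnto_eq_of_mem_right w (ρ g (v : H))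

lemma trainOp_one (ρ : GGroup Z Λ →* (H ≃ₗᵢ[ℂ] H)) (α : Train κ Z Λ) :
    trainOp ρ α α 1 = ContinuousLinearMap.id ℂ (fixedSubspace ρ α) := by
  ext1 v
  refine ext_inner_right ℂ fun w => ?_
  rw [inner_trainOp, map_one]
  rfl

lemma trainOp_inv (ρ : GGroup Z Λ →* (H ≃ₗᵢ[ℂ] H)) (α β : Train κ Z Λ) (g : GGroup Z Λ) :
    trainOp ρ β α g⁻¹ = ContinuousLinearMap.adjoint (trainOp ρ α β g) := by
  ext1 v
  refine ext_inner_right ℂ fun w => ?_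
  rw [ContinuousLinearMap.adjoint_inner_left, inner_trainOp, inner_rep_left, inv_inv,
    ← inner_conj_symm, ← inner_trainOp ρ g w v, inner_conj_symm]

lemma norm_trainOp_le (ρ : GGroup Z Λ →* (H ≃ₗᵢ[ℂ] H)) (α β : Train κ Z Λ) (g : GGroup Z Λ) :
    ‖trainOp ρ α β g‖ ≤ 1 := by
  refine ContinuousLinearMap.opNorm_le_bound _ zero_le_one fun v => ?_
  rw [one_mul]
  have h := (fixedSubspace ρ β).norm_orthogonalProjectionOnto_apply_le (ρ g (v : H))
  rw [LinearIsometryEquiv.norm_map] at h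
  exact h

/-- The operator of the limit double coset is the composition of operators. -/
lemma trainOp_comp (ρ : GGroup Z Λ →* (H ≃ₗᵢ[ℂ] H))
    (hρ : Dense (⋃ α : Train κ Z Λ, (fixedSubspace ρ α : Set H))) {α β γ : Train κ Z Λ}
    {g h : GGroup Z Λ} {A : fixedSubspace ρ α →L[ℂ] fixedSubspace ρ γ}
    (hA : ∀ᶠ N in atTop, trainOp ρ α γ (g * Theta Z Λ β.idx N * h) = A) :
    A = trainOp ρ β γ g ∘L trainOp ρ α β h := by
  ext1 v
  refine ext_inner_right ℂ fun w => ?_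
  -- The sequence $\langle\rho(g\Theta_N
  -- h)v,w\rangle=\langle\rho(\Theta_N)\rho(h)v,\rho(g^{-1})w\rangle$ has two limits: the one given
  -- by weak convergence, which inserts $P^\beta$, and its eventual constant value, the coefficient
  -- of `A`.
  have lim := tendsto_inner_Theta ρ hρ β (ρ h (v : H)) (ρ g⁻¹ (w : H))
  have lim' : Tendsto (fun N => inner ℂ (ρ (Theta Z Λ β.idx N) (ρ h (v : H))) (ρ g⁻¹ (w : H)))
      atTop (𝓝 (inner ℂ (A v) w)) := by
    refine tendsto_const_nhds.congr' ?_
    filter_upwards [hA] with N hN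
    rw [← hN, inner_trainOp, ← inner_rep_left, ← rep_mul_apply, ← rep_mul_apply, mul_assoc]
  rw [tendsto_nhds_unique lim' lim, ContinuousLinearMap.comp_apply, inner_trainOp,
    ← inner_rep_left]
  rfl

@[simp] lemma train_map_coset (π : AdmissibleRep.{u} κ Z Λ) (α β : Train κ Z Λ)
    (g : GGroup Z Λ) : π.train.map (Train.coset α β g) = trainOp π.ρ α β g := rfl

lemma Train.exists_eq_coset {α β : Train κ Z Λ} (𝔤 : α ⟶ β) : ∃ g, 𝔤 = Train.coset α β g := by
  obtain ⟨g, hg⟩ := Quotient.exists_rep 𝔤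
  exact ⟨g, hg.symm⟩

lemma Train.square_coset (α β : Train κ Z Λ) (g : GGroup Z Λ) :
    Train.square (Train.coset α β g) = Train.coset β α g⁻¹ := rfl

lemma Train.eventually_coset_eq_comp (α β γ : Train κ Z Λ) (g h : GGroup Z Λ) :
    ∀ᶠ N in atTop, Train.coset α γ (g * Theta Z Λ β.idx N * h) =
      Train.coset α β h ≫ Train.coset β γ g :=
  cosetMul_spec g h

/-- Admissibility is needed only for `map_comp`; the other axioms hold for compressions of any
unitary representation. -/
theorem AdmissibleRep.isContractiveStarRep_train (π : AdmissibleRep.{u} κ Z Λ) :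
    π.train.IsContractiveStarRep where
  map_id α := trainOp_one π.ρ α
  map_comp {α β γ} 𝔥 𝔤 := by
    obtain ⟨h, rfl⟩ := Train.exists_eq_coset 𝔥
    obtain ⟨g, rfl⟩ := Train.exists_eq_coset 𝔤
    exact trainOp_comp π.ρ π.admissible <|
      (Train.eventually_coset_eq_comp α β γ g h).mono fun N hN => congrArg π.train.map hN
  map_square {α β} 𝔤 := by
    obtain ⟨g, rfl⟩ := Train.exists_eq_coset 𝔤
    exact trainOp_inv π.ρ α β g
  norm_le_one {α β} 𝔤 := by
    obtain ⟨g, rfl⟩ := Train.exists_eq_coset 𝔤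
    exact norm_trainOp_le π.ρ α β g

end Forward

/-! ### Injectivity on equivalence classes, and invariance under unitary equivalence. -/

section Uniqueness

variable {p q : ℕ} {κ : PairKind} {Z : Matrix (Fin q) (Fin p) ℕ} {Λ : Fin q → ℕ}

/-- An admissible representation is determined up to unitary equivalence by its operators
`H^α → H^β`. -/
theorem AdmissibleRep.equiv_of_trainOp (π π' : AdmissibleRep.{u} κ Z Λ)
    (U : ∀ α : Train κ Z Λ, fixedSubspace π.ρ α ≃ₗᵢ[ℂ] fixedSubspace π'.ρ α)
    (hU : ∀ (α β : Train κ Z Λ) g v, U β (trainOp π.ρ α β g v) = trainOp π'.ρ α β g (U α v)) :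
    ∃ W : π.H ≃ₗᵢ[ℂ] π'.H, ∀ g v, W (π.ρ g v) = π'.ρ g (W v) := by
  let a : (Σ α : Train κ Z Λ, fixedSubspace π.ρ α) → π.H := fun x => x.2
  let b : (Σ α : Train κ Z Λ, fixedSubspace π.ρ α) → π'.H := fun x => U x.1 x.2
  have hinner : ∀ x y g, inner ℂ (π.ρ g (a x)) (a y) = inner ℂ (π'.ρ g (b x)) (b y) := by
    rintro ⟨α, v⟩ ⟨β, w⟩ g
    simp only [a, b]
    rw [← inner_trainOp, ← inner_trainOp, ← hU, LinearIsometryEquiv.inner_map_map]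
  have ha : DenseRange a := by
    refine π.admissible.mono fun v hv => ?_
    obtain ⟨α, hα⟩ := Set.mem_iUnion.1 hv
    exact ⟨⟨α, v, hα⟩, rfl⟩
  have hb : DenseRange b := by
    refine π'.admissible.mono fun v hv => ?_
    obtain ⟨α, hα⟩ := Set.mem_iUnion.1 hv
    exact ⟨⟨α, (U α).symm ⟨v, hα⟩⟩, by simp [b]⟩
  -- The case $g=1$ of `hinner` is equality of Gram matrices; the general case then shows that `W`
  -- intertwines, by testing on the dense families `a` and `b`.
  obtain ⟨W, hW⟩ := exists_isometryEquiv_of_inner_eq a b (ha.mono Submodule.subset_span)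
    (hb.mono Submodule.subset_span) (fun x y => by simpa using hinner x y 1)
  refine ⟨W, fun g v => ?_⟩
  refine congrFun (ha.equalizer (W.continuous.comp (π.ρ g).continuous)
    ((π'.ρ g).continuous.comp W.continuous) (funext fun x => ?_)) v
  refine hb.eq_of_inner_left ℂ fun y => ?_
  simp only [Function.comp_apply]
  rw [hW, ← hinner, ← hW, LinearIsometryEquiv.inner_map_map]

/-- Unitarily equivalent admissible representations give unitarily equivalent representations of
the train. -/
theorem AdmissibleRep.train_equiv_of_equiv {π π' : AdmissibleRep.{u} κ Z Λ}
    (h : ∃ W : π.H ≃ₗᵢ[ℂ] π'.H, ∀ g v, W (π.ρ g v) = π'.ρ g (W v)) :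
    ∃ U : ∀ α : Train κ Z Λ, π.train.V α ≃ₗᵢ[ℂ] π'.train.V α,
      ∀ (α β : Train κ Z Λ) (𝔤 : α ⟶ β) (v : π.train.V α),
        U β (π.train.map 𝔤 v) = π'.train.map 𝔤 (U α v) := by
  obtain ⟨W, hW⟩ := h
  have hmem : ∀ (α : Train κ Z Λ) (v : fixedSubspace π.ρ α), W v ∈ fixedSubspace π'.ρ α := by
    intro α v k hk
    rw [← hW, v.2 k hk]
  let J : ∀ α : Train κ Z Λ, fixedSubspace π.ρ α →ₗᵢ[ℂ] fixedSubspace π'.ρ α := fun α =>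
    { toLinearMap := (W.toLinearEquiv.toLinearMap ∘ₗ (fixedSubspace π.ρ α).subtype).codRestrict
        (fixedSubspace π'.ρ α) (hmem α)
      norm_map' := fun v => W.norm_map v }
  have hJ : ∀ α, Function.Surjective (J α) := by
    rintro α ⟨v, hv⟩
    refine ⟨⟨W.symm v, fun k hk => W.injective ?_⟩, Subtype.ext (W.apply_symm_apply v)⟩
    rw [hW, W.apply_symm_apply, hv k hk]
  refine ⟨fun α => LinearIsometryEquiv.ofSurjective (J α) (hJ α), fun α β 𝔤 v => ?_⟩
  obtain ⟨g, rfl⟩ := Train.exists_eq_coset 𝔤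
  have key : ∀ v : fixedSubspace π.ρ α,
      J β (trainOp π.ρ α β g v) = trainOp π'.ρ α β g (J α v) := by
    intro v
    refine ext_inner_right ℂ fun w => ?_
    -- Every test vector is the image of one in $H^\beta$, so unitarity of `W` removes it from both
    -- sides.
    obtain ⟨w, rfl⟩ := hJ β w
    rw [LinearIsometry.inner_map_map, inner_trainOp, inner_trainOp]
    change _ = inner ℂ (π'.ρ g (W v)) (W w)
    rw [← hW, LinearIsometryEquiv.inner_map_map]
  exact key v

end Uniqueness

/-! ### From a representation of the train back to the group: a GNS construction. -/

section Construction

variable {p q : ℕ} {κ : PairKind} {Z : Matrix (Fin q) (Fin p) ℕ} {Λ : Fin q → ℕ}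

/-- `γ` is large for `g` and `α`: it dominates `α`, and `K^γ` commutes with `g`. -/
def IsLarge (γ : Train κ Z Λ) (α : Train κ Z Λ) (g : GGroup Z Λ) : Prop :=
  (∀ i, α.idx i ≤ γ.idx i) ∧ ∀ k ∈ KSub κ Z Λ γ.idx, k * g = g * k

/-- Constant multi-indices beyond a threshold are used so that finitely many such requirements can
be met by one object. -/
lemma exists_isLarge (α : Train κ Z Λ) (g : GGroup Z Λ) :
    ∃ M, ∀ N, M ≤ N → IsLarge ⟨fun _ => N⟩ α g := by
  obtain ⟨M, hM⟩ := exists_commute κ g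
  refine ⟨M + Finset.univ.sup α.idx, fun N hN => ⟨fun i => ?_, fun k hk => ?_⟩⟩
  · have : α.idx i ≤ Finset.univ.sup α.idx := Finset.le_sup (Finset.mem_univ i)
    change α.idx i ≤ N
    omega
  · exact hM k (KSub_anti (fun i => by change M ≤ N; omega) hk)

/-- Composition through a large object is multiplication of representatives. -/
lemma IsLarge.coset_comp {α β γ : Train κ Z Λ} {g : GGroup Z Λ} (hγ : IsLarge γ α g)
    (h : GGroup Z Λ) : Train.coset α γ g ≫ Train.coset γ β h = Train.coset α β (h * g) :=
  -- Since $\Theta_N\in K^\gamma$ commutes with $g$, $h\Theta_N g=hg\Theta_N$, and $K^\gamma\subset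
  -- K^\alpha$ absorbs $\Theta_N$ on the right, already from $N=0$ on.
  cosetMul_eq 0 fun N _ => (mk_eq_iff.2 ⟨1, one_mem _, Theta Z Λ γ.idx N,
    KSub_anti hγ.1 (Theta_mem _ N), by
      rw [mul_assoc h, hγ.2 _ (Theta_mem _ N)]; group⟩).symm

lemma coset_mul_right {α β : Train κ Z Λ} (g : GGroup Z Λ) {k : GGroup Z Λ}
    (hk : k ∈ KSub κ Z Λ α.idx) : Train.coset α β (g * k) = Train.coset α β g :=
  (mk_eq_iff.2 ⟨1, one_mem _, k, hk, by group⟩).symm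

variable (T : OperatorFamily.{u} κ Z Λ)

/-- The index set of the total family of vectors `ρ(g) v`, where `v ∈ V_α`. -/
abbrev Orbit : Type u := GGroup Z Λ × Σ α, T.V α

/-- The inner product of `ρ(g) v` and `ρ(h) w`. -/
noncomputable def orbitKernel (x y : Orbit T) : ℂ :=
  inner ℂ (T.map (Train.coset x.2.1 y.2.1 (y.1⁻¹ * x.1)) x.2.2) y.2.2

variable {T}

/-- The coset of $y^{-1}x$ factors through `γ`; its second factor is the involution of the coset of
$y$, so its operator is an adjoint and moves across the inner product. Largeness is needed for `x`
alone. -/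
lemma orbitKernel_eq_inner (hT : T.IsContractiveStarRep) {γ : Train κ Z Λ} {x y : Orbit T}
    (hx : IsLarge γ x.2.1 x.1) : orbitKernel T x y =
      inner ℂ (T.map (Train.coset x.2.1 γ x.1) x.2.2) (T.map (Train.coset y.2.1 γ y.1) y.2.2) := by
  rw [orbitKernel, ← hx.coset_comp, hT.map_comp, ← Train.square_coset, hT.map_square,
    ContinuousLinearMap.comp_apply, ContinuousLinearMap.adjoint_inner_left]

/-- A single space $V_\gamma$, with `γ` past the thresholds of all elements of `s`, realizes the
kernel on `s`. -/
lemma exists_gram_orbitKernel (hT : T.IsContractiveStarRep) (s : Finset (Orbit T)) :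
    ∃ (E : Type u) (_ : NormedAddCommGroup E) (_ : InnerProductSpace ℂ E)
      (φ : Orbit T → E), ∀ x ∈ s, ∀ y ∈ s, orbitKernel T x y = inner ℂ (φ x) (φ y) := by
  choose M hM using fun x : Orbit T => exists_isLarge x.2.1 x.1
  exact ⟨T.V ⟨fun _ => s.sup M⟩, inferInstance, inferInstance,
    fun x => T.map (Train.coset x.2.1 _ x.1) x.2.2,
    fun x hx y _ => orbitKernel_eq_inner hT (hM x _ (Finset.le_sup hx))⟩

variable {H : Type u} [NormedAddCommGroup H] [InnerProductSpace ℂ H]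

/-- The isometric embedding of `V_α`. -/
noncomputable def orbitEmbedding (hT : T.IsContractiveStarRep) {a : Orbit T → H}
    (ha : ∀ x y, inner ℂ (a x) (a y) = orbitKernel T x y)
    (hd : Dense (Submodule.span ℂ (Set.range a) : Set H)) (α : Train κ Z Λ) :
    T.V α →ₗᵢ[ℂ] H where
  toFun v := a (1, ⟨α, v⟩)
  map_add' v w := by
    -- `a` is a mere family of vectors; its linearity in `v` is read off from inner products with
    -- the total family.
    refine eq_of_inner_eq_of_dense_span hd fun y => ?_
    simp [ha, orbitKernel]
  map_smul' c v := by
    refine eq_of_inner_eq_of_dense_span hd fun y => ?_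
    simp [ha, orbitKernel]
  norm_map' v := by
    have h1 : T.map (Train.coset α α 1) = ContinuousLinearMap.id ℂ (T.V α) := hT.map_id α
    change ‖a (1, ⟨α, v⟩)‖ = ‖v‖
    rw [@norm_eq_sqrt_re_inner ℂ, @norm_eq_sqrt_re_inner ℂ, ha]
    simp [orbitKernel, h1]

/-- Translates bring nothing new: $\rho(g)v$ already lies in the copy of $V_\gamma$ for `γ` large,
so these copies together span a dense subspace. -/
lemma orbit_eq_embedding (hT : T.IsContractiveStarRep) {a : Orbit T → H}
    (ha : ∀ x y, inner ℂ (a x) (a y) = orbitKernel T x y)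
    (hd : Dense (Submodule.span ℂ (Set.range a) : Set H)) {γ : Train κ Z Λ} {x : Orbit T}
    (hx : IsLarge γ x.2.1 x.1) :
    a x = orbitEmbedding hT ha hd γ (T.map (Train.coset x.2.1 γ x.1) x.2.2) := by
  refine eq_of_inner_eq_of_dense_span hd fun y => ?_
  change _ = inner ℂ (a (1, ⟨γ, _⟩)) (a y)
  rw [ha, ha, orbitKernel, orbitKernel, mul_one, ← ContinuousLinearMap.comp_apply, ← hT.map_comp,
    hx.coset_comp]

/-- This identifies the operators of `T` with the compressions of $\rho$ to the embedded spaces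
$V_\alpha$, which need not yet be all of $H^\alpha$. -/
lemma inner_rep_embedding (hT : T.IsContractiveStarRep) {a : Orbit T → H}
    (ha : ∀ x y, inner ℂ (a x) (a y) = orbitKernel T x y)
    (hd : Dense (Submodule.span ℂ (Set.range a) : Set H))
    {ρ : GGroup Z Λ →* (H ≃ₗᵢ[ℂ] H)} (hρ : ∀ g x, ρ g (a x) = a (g * x.1, x.2))
    {α β : Train κ Z Λ} (g : GGroup Z Λ) (v : T.V α) (w : T.V β) :
    inner ℂ (ρ g (orbitEmbedding hT ha hd α v)) (orbitEmbedding hT ha hd β w) =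
      inner ℂ (T.map (Train.coset α β g) v) w := by
  change inner ℂ (ρ g (a (1, ⟨α, v⟩))) (a (1, ⟨β, w⟩)) = _
  rw [hρ, ha, orbitKernel]
  simp

/-- Inner products with the total family depend on $k$ only through the coset of $y^{-1}k$, where
$k\in K^\alpha$ is absorbed on the right. -/
lemma embedding_mem_fixedSubspace (hT : T.IsContractiveStarRep) {a : Orbit T → H}
    (ha : ∀ x y, inner ℂ (a x) (a y) = orbitKernel T x y)
    (hd : Dense (Submodule.span ℂ (Set.range a) : Set H))
    {ρ : GGroup Z Λ →* (H ≃ₗᵢ[ℂ] H)} (hρ : ∀ g x, ρ g (a x) = a (g * x.1, x.2))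
    {α : Train κ Z Λ} (v : T.V α) : orbitEmbedding hT ha hd α v ∈ fixedSubspace ρ α := by
  intro k hk
  refine eq_of_inner_eq_of_dense_span hd fun y => ?_
  change inner ℂ (ρ k (a (1, ⟨α, v⟩))) (a y) = inner ℂ (a (1, ⟨α, v⟩)) (a y)
  rw [hρ, ha, ha, orbitKernel, orbitKernel]
  simp only [mul_one, coset_mul_right _ hk]

lemma dense_iUnion_fixedSubspace (hT : T.IsContractiveStarRep) {a : Orbit T → H}
    (ha : ∀ x y, inner ℂ (a x) (a y) = orbitKernel T x y)
    (hd : Dense (Submodule.span ℂ (Set.range a) : Set H))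
    {ρ : GGroup Z Λ →* (H ≃ₗᵢ[ℂ] H)} (hρ : ∀ g x, ρ g (a x) = a (g * x.1, x.2)) :
    Dense (⋃ α : Train κ Z Λ, (fixedSubspace ρ α : Set H)) := by
  refine hd.mono fun v hv => ?_
  refine Set.mem_iUnion.2 (exists_mem_fixedSubspace_of_mem_span ρ (Submodule.span_mono ?_ hv))
  rintro _ ⟨x, rfl⟩
  obtain ⟨M, hM⟩ := exists_isLarge x.2.1 x.1
  rw [orbit_eq_embedding hT ha hd (hM M le_rfl)]
  exact Set.mem_iUnion.2 ⟨_, embedding_mem_fixedSubspace hT ha hd hρ _⟩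

variable [CompleteSpace H]

/-- A total family with Gram kernel `orbitKernel T` carries a unitary representation of `G`. -/
theorem exists_rep_of_orbit {a : Orbit T → H}
    (ha : ∀ x y, inner ℂ (a x) (a y) = orbitKernel T x y)
    (hd : Dense (Submodule.span ℂ (Set.range a) : Set H)) :
    ∃ ρ : GGroup Z Λ →* (H ≃ₗᵢ[ℂ] H), ∀ g x, ρ g (a x) = a (g * x.1, x.2) := by
  have key : ∀ g : GGroup Z Λ, ∃ U : H ≃ₗᵢ[ℂ] H, ∀ x, U (a x) = a (g * x.1, x.2) := by
    intro g
    -- Left translation permutes the index set, so the translated family is again total; its Gram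
    -- kernel is unchanged because $(gy)^{-1}(gx)=y^{-1}x$.
    have hr : Set.range (fun x : Orbit T => a (g * x.1, x.2)) = Set.range a := by
      refine Set.Subset.antisymm ?_ ?_
      · rintro _ ⟨x, rfl⟩
        exact ⟨_, rfl⟩
      · rintro _ ⟨x, rfl⟩
        exact ⟨(g⁻¹ * x.1, x.2), by simp⟩
    refine exists_isometryEquiv_of_inner_eq a _ hd (by rwa [hr]) fun x y => ?_
    rw [ha, ha, orbitKernel, orbitKernel]
    congr 4
    group
  choose ρ hρ using key
  -- Operators are determined on the total family, which makes the separately chosen unitaries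
  -- multiplicative.
  have hext : ∀ U W : H ≃ₗᵢ[ℂ] H, (∀ x, U (a x) = W (a x)) → U = W := by
    intro U W h
    have : (U.toContinuousLinearEquiv : H →L[ℂ] H) = W.toContinuousLinearEquiv :=
      ContinuousLinearMap.ext_on hd (by rintro _ ⟨x, rfl⟩; exact h x)
    exact LinearIsometryEquiv.ext fun v => DFunLike.congr_fun this v
  refine ⟨{ toFun := ρ
            map_one' := hext _ _ fun x => ?_
            map_mul' := fun g h => hext _ _ fun x => ?_ }, hρ⟩
  · rw [hρ, one_mul]; rfl
  · change ρ (g * h) (a x) = ρ g (ρ h (a x))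
    rw [hρ, hρ, hρ, mul_assoc]

/-- The orthogonal projection to `H^α` maps `V_γ` to `V_α` by the operator of the double coset
of `1`. -/
lemma projection_embedding (hT : T.IsContractiveStarRep) {a : Orbit T → H}
    (ha : ∀ x y, inner ℂ (a x) (a y) = orbitKernel T x y)
    (hd : Dense (Submodule.span ℂ (Set.range a) : Set H))
    {ρ : GGroup Z Λ →* (H ≃ₗᵢ[ℂ] H)} (hρ : ∀ g x, ρ g (a x) = a (g * x.1, x.2))
    (α γ : Train κ Z Λ) (v : T.V γ) :
    ((fixedSubspace ρ α).orthogonalProjectionOnto (orbitEmbedding hT ha hd γ v) : H) =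
      orbitEmbedding hT ha hd α (T.map (Train.coset γ α 1) v) := by
  refine eq_of_inner_eq_of_dense_span hd fun y => ?_
  obtain ⟨M, hM⟩ := exists_isLarge y.2.1 y.1
  rw [orbit_eq_embedding hT ha hd (hM M le_rfl)]
  generalize T.map _ y.2.2 = w
  -- The projection is the weak limit of $\rho(\Theta_N^{[\alpha]})$. The coefficient of
  -- $\rho(\Theta_N^{[\alpha]})$ is that of $T$ at the coset of $1\cdot\Theta_N^{[\alpha]}\cdot 1$,
  -- which is eventually the composition through `α` of two cosets of $1$.
  have lim := tendsto_inner_Theta ρ (dense_iUnion_fixedSubspace hT ha hd hρ) α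
    (orbitEmbedding hT ha hd γ v) (orbitEmbedding hT ha hd _ w)
  refine tendsto_nhds_unique lim (tendsto_const_nhds.congr' ?_)
  filter_upwards [Train.eventually_coset_eq_comp γ α ⟨fun _ => M⟩ 1 1] with N hN
  rw [one_mul, mul_one] at hN
  have h1 := inner_rep_embedding hT ha hd hρ 1 (T.map (Train.coset γ α 1) v) w
  rw [map_one] at h1
  rw [inner_rep_embedding hT ha hd hρ, hN, hT.map_comp]
  exact h1

/-- $P^\alpha$ sends the total family into the embedded $V_\alpha$, which is closed, being the
isometric image of a complete space. Hence $P^\alpha$ sends all of `H` there, and it fixes `v`. -/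
lemma mem_range_embedding (hT : T.IsContractiveStarRep) {a : Orbit T → H}
    (ha : ∀ x y, inner ℂ (a x) (a y) = orbitKernel T x y)
    (hd : Dense (Submodule.span ℂ (Set.range a) : Set H))
    {ρ : GGroup Z Λ →* (H ≃ₗᵢ[ℂ] H)} (hρ : ∀ g x, ρ g (a x) = a (g * x.1, x.2))
    {α : Train κ Z Λ} {v : H} (hv : v ∈ fixedSubspace ρ α) :
    v ∈ LinearMap.range (orbitEmbedding hT ha hd α).toLinearMap := by
  set R := LinearMap.range (orbitEmbedding hT ha hd α).toLinearMap with hR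
  have hRc : IsClosed (R : Set H) := by
    have : (R : Set H) = Set.range (orbitEmbedding hT ha hd α) := by
      rw [hR, LinearMap.coe_range]; rfl
    rw [this]
    exact (orbitEmbedding hT ha hd α).isometry.isClosedEmbedding.isClosed_range
  let P : H →L[ℂ] H := (fixedSubspace ρ α).subtypeL ∘L (fixedSubspace ρ α).orthogonalProjectionOnto
  have hle : Submodule.span ℂ (Set.range a) ≤ R.comap P.toLinearMap := by
    rw [Submodule.span_le]
    rintro _ ⟨x, rfl⟩
    obtain ⟨M, hM⟩ := exists_isLarge x.2.1 x.1
    rw [orbit_eq_embedding hT ha hd (hM M le_rfl)]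
    exact ⟨_, (projection_embedding hT ha hd hρ α _ _).symm⟩
  have hall : ∀ x, P x ∈ R := fun x =>
    (hRc.preimage P.continuous).closure_subset_iff.2 hle (hd x)
  have hPv : P v = v :=
    congrArg Subtype.val
      (Submodule.orthogonalProjectionOnto_mem_subspace_eq_self (⟨v, hv⟩ : fixedSubspace ρ α))
  rw [← hPv]
  exact hall v

/-- Every contractive `*`-representation of the train comes from an admissible representation. -/
theorem OperatorFamily.IsContractiveStarRep.exists_admissibleRep (hT : T.IsContractiveStarRep) :
    ∃ (π : AdmissibleRep.{u} κ Z Λ) (U : ∀ α, T.V α ≃ₗᵢ[ℂ] fixedSubspace π.ρ α),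
      ∀ (α β : Train κ Z Λ) (g : GGroup Z Λ) (v : T.V α),
        U β (T.map (Train.coset α β g) v) = trainOp π.ρ α β g (U α v) := by
  obtain ⟨H, _, _, _, a, ha, hd⟩ :=
    exists_hilbert_of_kernel (orbitKernel T) (exists_gram_orbitKernel hT)
  obtain ⟨ρ, hρ⟩ := exists_rep_of_orbit ha hd
  let J : ∀ α, T.V α →ₗᵢ[ℂ] fixedSubspace ρ α := fun α =>
    { toLinearMap := (orbitEmbedding hT ha hd α).toLinearMap.codRestrict (fixedSubspace ρ α)
        (embedding_mem_fixedSubspace hT ha hd hρ)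
      norm_map' := fun v => (orbitEmbedding hT ha hd α).norm_map v }
  have hJ : ∀ α, Function.Surjective (J α) := by
    rintro α ⟨v, hv⟩
    obtain ⟨w, hw⟩ := mem_range_embedding hT ha hd hρ hv
    exact ⟨w, Subtype.ext hw⟩
  refine ⟨⟨H, ρ, dense_iUnion_fixedSubspace hT ha hd hρ⟩,
    fun α => LinearIsometryEquiv.ofSurjective (J α) (hJ α), fun α β g v => ?_⟩
  refine ext_inner_right ℂ fun w => ?_
  obtain ⟨w, rfl⟩ := hJ β w
  refine ((J β).inner_map_map _ _).trans ?_
  refine Eq.trans ?_ (inner_trainOp ρ g (J α v) (J β w)).symm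
  exact (inner_rep_embedding hT ha hd hρ g v w).symm

end Construction

end SymTrain

/-! ### The bijection between equivalence classes. -/

theorem mainTheorem3 {p q : ℕ} (hp : 0 < p) (hq : 0 < q)
    (Z : Matrix (Fin q) (Fin p) ℕ) (hrow : ∀ j, ∃ i, Z j i ≠ 0) (hcol : ∀ i, ∃ j, Z j i ≠ 0)
    (Λ : Fin q → ℕ) (κ : SymTrain.PairKind) :
    ∃ h : ∀ π : SymTrain.AdmissibleRep.{u} κ Z Λ, π.train.IsContractiveStarRep,
      ∃ Φ : Quotient (SymTrain.AdmissibleRep.setoid.{u} κ Z Λ) ≃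
          Quotient (SymTrain.StarRep.setoid.{u} κ Z Λ),
        ∀ π : SymTrain.AdmissibleRep.{u} κ Z Λ,
          Φ (Quotient.mk _ π) = Quotient.mk _ ⟨π.train, h π⟩ := by
  refine ⟨SymTrain.AdmissibleRep.isContractiveStarRep_train, ?_⟩
  let F : Quotient (SymTrain.AdmissibleRep.setoid.{u} κ Z Λ) →
      Quotient (SymTrain.StarRep.setoid.{u} κ Z Λ) :=
    Quotient.map (fun π => ⟨π.train, π.isContractiveStarRep_train⟩)
      fun π π' h => SymTrain.AdmissibleRep.train_equiv_of_equiv h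
  refine ⟨Equiv.ofBijective F ⟨?_, ?_⟩, fun π => rfl⟩
  · intro x y
    induction x using Quotient.inductionOn with | _ π
    induction y using Quotient.inductionOn with | _ π'
    intro h
    obtain ⟨U, hU⟩ := Quotient.exact h
    exact Quotient.sound (SymTrain.AdmissibleRep.equiv_of_trainOp π π' U
      fun α β g v => hU α β (SymTrain.Train.coset α β g) v)
  · intro y
    induction y using Quotient.inductionOn with | _ T
    obtain ⟨π, U, hU⟩ := T.2.exists_admissibleRep
    refine ⟨Quotient.mk _ π, Eq.symm (Quotient.sound ⟨U, fun α β 𝔤 v => ?_⟩)⟩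
    obtain ⟨g, rfl⟩ := SymTrain.Train.exists_eq_coset 𝔤
    exact hU α β g v
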